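/- Let $0<\alpha\le 1/2$ and let $S(\alpha,1,1)$ denote the maximally skewed $\alpha$-stable law with unit scale, i.e. the probability law on $\mathbb{R}$ with characteristic function $\lambda\mapsto\exp\left(-|\lambda|^\alpha\left(1-\operatorname{sign}(\lambda)\sqrt{-1}\tan\frac{\pi\alpha}{2}\right)\right)$. For $t\ge0$ let $F_\alpha(t)=\Pr\left((S_2/S_1)^{\alpha/(1-\alpha)}\le t\right)$, where $S_1,S_2\sim S(\alpha,1,1)$ are i.i.d., and for $M\ge1$ let $$D_{M,\alpha}=\int_0^\infty\left[1-F_\alpha\left(t^{\alpha/(1-\alpha)}\right)\right]^M dt\in[0,\infty].$$ Let $x=(x_1,\dots,x_N)\in\mathbb{R}^N$ with all $x_i\ge0$, let $s_{ij}\sim S(\alpha,1,1)$ ($1\le i\le N$, $1\le j\le M$) be i.i.d., and put $y_j=\sum_{i=1}^N x_is_{ij}$, $\hat x_{i,\min}=\min_{1\le j\le M} y_j/s_{ij}$ and $\theta_i=\left(\sum_{t\ne i}x_t^\alpha\right)^{1/\alpha}$. Then for every $i$, almost surely $\hat x_{i,\min}\ge x_i$, and $$E\left(\hat x_{i,\min}\right)=x_i+\theta_i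 D_{M,\alpha}$$ as an identity in $[0,\infty]$ (with $0\cdot\infty=0$); in particular, if $D_{M,\alpha}<\infty$ then $\hat x_{i,\min}$ is integrable and the identity holds between real numbers. For $\alpha=1/2$ and every $M\ge3$, the constant $D_{M,1/2}$ is finite, the following series converges absolutely, and $$D_{M,1/2}=M(M-1)\frac{4}{\pi^2}\sum_{j=0}^\infty\frac{(-1)^j\pi^{2j}}{(M+2j-2)\,(2j)!}B_{2j}-1,$$ where the Bernoulli numbers $B_j$ are given by $\frac{t}{e^t-1}=\sum_{j=0}^\infty B_j\frac{t^j}{j!}$. -/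

import Mathlib

open MeasureTheory ProbabilityTheory

noncomputable section

/-- `ν` is the maximally skewed `α`-stable law `S(α,1,1)` (skewness `1`, unit scale): the probability
measure on `ℝ` with characteristic function `exp (-|l|^α (1 - sign(l) √-1 tan(πα/2)))`. -/
structure IsSkewedStable (α : ℝ) (ν : Measure ℝ) : Prop where
  isProbabilityMeasure : IsProbabilityMeasure ν
  charFun_eq : ∀ l : ℝ, charFun ν l =
    Complex.exp (-((|l| ^ α : ℝ) : ℂ) *
      (1 - ((SignType.sign l : ℝ) : ℂ) * Complex.I * ((Real.tan (Real.pi * α / 2) : ℝ) : ℂ)))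

/-- A law is determined by its characteristic function. -/
theorem IsSkewedStable.unique {α : ℝ} {μ ν : Measure ℝ}
    (hμ : IsSkewedStable α μ) (hν : IsSkewedStable α ν) : μ = ν := by
  have := hμ.isProbabilityMeasure
  have := hν.isProbabilityMeasure
  refine Measure.ext_of_charFun ?_
  funext l
  rw [hμ.charFun_eq, hν.charFun_eq]

open Classical in
/-- The law `S(α,1,1)`. It is unique by `IsSkewedStable.unique`, and it exists for every
`α ∈ (0,1)`; the value `0` is a placeholder for those `α` for which there is no such law. -/
def skewedStable (α : ℝ) : Measure ℝ :=
  if h : ∃ ν : Measure ℝ, IsSkewedStable α ν then h.choose else 0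

theorem IsSkewedStable.eq_skewedStable {α : ℝ} {ν : Measure ℝ} (hν : IsSkewedStable α ν) :
    ν = skewedStable α := by
  have h : ∃ ν : Measure ℝ, IsSkewedStable α ν := ⟨ν, hν⟩
  rw [skewedStable, dif_pos h]
  exact hν.unique h.choose_spec

/-- `F_α(t) = Pr ((S₂ / S₁)^(α/(1-α)) ≤ t)` for `S₁, S₂ ∼ S(α,1,1)` i.i.d.
(`p = (S₁, S₂)` has the product law). -/
def ratioCDF (α t : ℝ) : ℝ :=
  ((skewedStable α).prod (skewedStable α)).real
    {p : ℝ × ℝ | (p.2 / p.1) ^ (α / (1 - α)) ≤ t}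

/-- `D_{M,α} = ∫_0^∞ [1 - F_α(t^(α/(1-α)))]^M dt`, the integral of a nonnegative function, with
value in `[0,∞]`. -/
def biasConst (M : ℕ) (α : ℝ) : ENNReal :=
  ∫⁻ t in Set.Ioi (0 : ℝ), ENNReal.ofReal ((1 - ratioCDF α (t ^ (α / (1 - α)))) ^ M)

/-- `θ_i = (∑_{t ≠ i} x_t^α)^(1/α)`. -/
def thetaOther {N : ℕ} (α : ℝ) (x : Fin N → ℝ) (i : Fin N) : ℝ :=
  (∑ t ∈ Finset.univ.erase i, x t ^ α) ^ (1 / α)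

/-- The `j`-th linear measurement `y_j = ∑_i x_i s_{ij}` of the signal `x`. -/
def measurement {N M : ℕ} (x : Fin N → ℝ) (s : Fin N → Fin M → ℝ) (j : Fin M) : ℝ :=
  ∑ i, x i * s i j

/-- The minimum estimator `min_{1 ≤ j ≤ M} y_j / s_{ij}` of the coordinate `x_i`. -/
def minEstimator {N M : ℕ} (x : Fin N → ℝ) (s : Fin N → Fin M → ℝ) (i : Fin N) : ℝ :=
  ⨅ j : Fin M, measurement x s j / s i j

/-- The `j`-th term `(-1)^j π^{2j} B_{2j} / ((M+2j-2) (2j)!)`; Mathlib's `bernoulli` has the generating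
function `t / (e^t - 1)`. -/
def biasTerm (M j : ℕ) : ℝ :=
  (-1) ^ j * Real.pi ^ (2 * j) / (((M : ℝ) + 2 * j - 2) * ((2 * j).factorial : ℝ)) *
    (bernoulli (2 * j) : ℝ)

end

/-- The Laplace transform `exp (-w^α / cos (πα/2))` of the law `S(α,1,1)`. -/
noncomputable def stableLaplace (α : ℝ) (w : ℂ) : ℂ :=
  Complex.exp (-(w ^ (α : ℂ) / (Real.cos (Real.pi * α / 2) : ℂ)))

theorem cos_pi_mul_half_pos {α : ℝ} (h0 : 0 < α) (h1 : α < 1) :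
    0 < Real.cos (Real.pi * α / 2) := by
  apply Real.cos_pos_of_mem_Ioo
  have := Real.pi_pos
  constructor <;> nlinarith

/-- Re w^α = |w|^α cos(α arg w), and |arg w| ≤ π/2 gives cos(α arg w) ≥ cos(πα/2), which cancels the
denominator. -/
theorem norm_stableLaplace_le {α : ℝ} (h0 : 0 < α) (h1 : α < 1) {w : ℂ} (hw : 0 ≤ w.re) :
    ‖stableLaplace α w‖ ≤ Real.exp (-‖w‖ ^ α) := by
  have hc := cos_pi_mul_half_pos h0 h1
  rw [stableLaplace, Complex.norm_exp, Real.exp_le_exp, Complex.neg_re, Complex.div_ofReal_re,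
    Complex.cpow_ofReal_re, neg_le_neg_iff, le_div_iff₀ hc]
  apply mul_le_mul_of_nonneg_left _ (by positivity)
  rw [← Real.cos_abs (w.arg * α), abs_mul, abs_of_pos h0]
  have h := Complex.abs_arg_le_pi_div_two_iff.2 hw
  have := Real.pi_pos
  apply Real.cos_le_cos_of_nonneg_of_le_pi (by positivity) <;> nlinarith

theorem norm_stableLaplace_add_le {α : ℝ} (h0 : 0 < α) (h1 : α < 1) {x : ℝ} (hx : 0 ≤ x) (y : ℝ) :
    ‖stableLaplace α (x + y * Complex.I)‖ ≤ Real.exp (-|y| ^ α) := by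
  refine (norm_stableLaplace_le h0 h1 (by simpa using hx)).trans ?_
  rw [Real.exp_le_exp, neg_le_neg_iff]
  apply Real.rpow_le_rpow (abs_nonneg _) _ h0.le
  simpa using Complex.abs_im_le_norm (x + y * Complex.I)

theorem continuousAt_stableLaplace {α : ℝ} (h0 : 0 < α) {w : ℂ} (hw : 0 ≤ w.re) :
    ContinuousAt (stableLaplace α) w := by
  unfold stableLaplace
  have := Complex.continuousAt_cpow_const_of_re_pos (z := w) (w := (α : ℂ)) (Or.inl hw) (by simpa)
  fun_prop

theorem differentiableAt_stableLaplace {α : ℝ} {w : ℂ} (hw : 0 < w.re) :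
    DifferentiableAt ℂ (stableLaplace α) w := by
  unfold stableLaplace
  have : w ∈ Complex.slitPlane := Or.inl hw
  fun_prop (disch := assumption)

theorem stableLaplace_neg_mul_I {α : ℝ} (h0 : 0 < α) (h1 : α < 1) (l : ℝ) :
    stableLaplace α (-(l * Complex.I)) =
      Complex.exp (-((|l| ^ α : ℝ) : ℂ) *
        (1 - ((SignType.sign l : ℝ) : ℂ) * Complex.I *
          ((Real.tan (Real.pi * α / 2) : ℝ) : ℂ))) := by
  have hc := cos_pi_mul_half_pos h0 h1
  have hc' : ((Real.cos (Real.pi * α / 2) : ℝ) : ℂ) ≠ 0 := by exact_mod_cast hc.ne'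
  rw [stableLaplace]
  congr 1
  rw [Complex.cpow_ofReal, Real.tan_eq_sin_div_cos]
  simp only [norm_neg, norm_mul, Complex.norm_I, mul_one, Complex.norm_real, Real.norm_eq_abs]
  rcases lt_trichotomy l 0 with hl | rfl | hl
  · have : (-(l * Complex.I)).arg = Real.pi / 2 := by
      rw [show -(l * Complex.I) = ((-l : ℝ) : ℂ) * Complex.I by push_cast; ring,
        Complex.arg_real_mul _ (by linarith), Complex.arg_I]
    rw [this, sign_neg hl, show Real.pi / 2 * α = Real.pi * α / 2 by ring]
    simp only [SignType.coe_neg, SignType.coe_one]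
    push_cast at hc' ⊢
    field_simp
    ring
  · simp [h0.ne']
  · have : (-(l * Complex.I)).arg = -(Real.pi / 2) := by
      rw [show -(l * Complex.I) = (l : ℂ) * (-Complex.I) by ring,
        Complex.arg_real_mul _ hl, Complex.arg_neg_I]
    rw [this, sign_pos hl, show -(Real.pi / 2) * α = -(Real.pi * α / 2) by ring, Real.cos_neg,
      Real.sin_neg]
    simp only [SignType.coe_one]
    push_cast at hc' ⊢
    field_simp
    ring

theorem integrable_exp_neg_abs_rpow {α : ℝ} (h0 : 0 < α) :
    Integrable fun y : ℝ => Real.exp (-|y| ^ α) := by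
  have h : IntegrableOn (fun y : ℝ => Real.exp (-|y| ^ α)) (Set.Ioi 0) := by
    refine (integrableOn_rpow_mul_exp_neg_rpow (s := 0) (by norm_num) h0).congr_fun ?_
      measurableSet_Ioi
    intro y hy
    simp [abs_of_pos (Set.mem_Ioi.1 hy)]
  rw [← integrableOn_univ, ← Set.Iic_union_Ioi (a := (0 : ℝ)), integrableOn_union]
  refine ⟨?_, h⟩
  rw [← neg_zero, ← integrableOn_Ici_iff_integrableOn_Ioi] at *
  simpa using h.comp_neg_Iic

/-! ### Moving the inversion contour to the right -/

section Contour
open Filter Topology Complex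

theorem integrable_cexp_mul_stableLaplace {α : ℝ} (h0 : 0 < α) (h1 : α < 1) (x : ℝ) {T : ℝ}
    (hT : 0 ≤ T) :
    Integrable fun y : ℝ => cexp (x * (T + y * I)) * stableLaplace α (T + y * I) := by
  refine ((integrable_exp_neg_abs_rpow h0).const_mul (Real.exp (x * T))).mono' ?_ ?_
  · apply Continuous.aestronglyMeasurable
    apply Continuous.mul (by fun_prop)
    rw [continuous_iff_continuousAt]
    intro y
    have h : ContinuousAt (stableLaplace α) ((fun y : ℝ => (T + y * I : ℂ)) y) :=
      continuousAt_stableLaplace h0 (by simpa using hT)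
    exact ContinuousAt.comp (g := stableLaplace α) (f := fun y : ℝ => (T + y * I : ℂ)) h
      (by fun_prop)
  · refine Eventually.of_forall fun y => ?_
    rw [norm_mul, Complex.norm_exp]
    simp only [mul_re, ofReal_re, add_re, I_re, mul_zero, ofReal_im, I_im, mul_one, sub_self,
      add_zero, add_im, mul_im, zero_add, zero_mul, sub_zero]
    exact mul_le_mul_of_nonneg_left (norm_stableLaplace_add_le h0 h1 hT y) (by positivity)

theorem integral_cexp_mul_stableLaplace_shift {α : ℝ} (h0 : 0 < α) (h1 : α < 1) {x : ℝ}
    (hx : x < 0) {T : ℝ} (hT : 0 ≤ T) :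
    ∫ y : ℝ, cexp (x * (y * I)) * stableLaplace α (y * I) =
      ∫ y : ℝ, cexp (x * (T + y * I)) * stableLaplace α (T + y * I) := by
  set H : ℂ → ℂ := fun w => cexp (x * w) * stableLaplace α w with hH
  have hrect : ∀ R : ℝ, 0 ≤ R →
      ((∫ t : ℝ in 0..T, H (t + ((-R : ℝ) : ℂ) * I)) - ∫ t : ℝ in 0..T, H (t + (R : ℂ) * I)) +
        I • (∫ y : ℝ in (-R)..R, H ((T : ℂ) + y * I)) -
        I • (∫ y : ℝ in (-R)..R, H (((0 : ℝ) : ℂ) + y * I)) = 0 := by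
    intro R hR
    -- The left side of the rectangle contains the branch point 0 of w^α, so holomorphy is used only
    -- in the interior and continuity up to the boundary.
    have := integral_boundary_rect_eq_zero_of_continuousOn_of_differentiableOn H
      (⟨0, -R⟩ : ℂ) (⟨T, R⟩ : ℂ) ?_ ?_
    · simpa only using this
    · intro w hw
      have hw0 : 0 ≤ w.re := by
        have := hw.1
        simp only [Set.mem_preimage, Set.uIcc_of_le hT] at this
        exact this.1
      have := continuousAt_stableLaplace h0 hw0
      exact ContinuousAt.continuousWithinAt (by fun_prop)
    · intro w hw
      have hw0 : 0 < w.re := by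
        have := hw.1
        simp only [Set.mem_preimage, min_eq_left hT] at this
        exact this.1
      have := differentiableAt_stableLaplace (α := α) hw0
      exact DifferentiableAt.differentiableWithinAt (by fun_prop)
  -- Top and bottom sides together, with ε R = ±R: there |e^{xw}| ≤ 1 since x < 0, and the remaining
  -- factor is at most exp(-|R|^α).
  have hside : ∀ ε : ℝ → ℝ, (∀ R, |ε R| = |R|) →
      Tendsto (fun R : ℝ => ∫ t : ℝ in 0..T, H (t + (ε R : ℂ) * I)) atTop (𝓝 0) := by
    intro ε hε
    have hlim : Tendsto (fun R : ℝ => Real.exp (-|R| ^ α) * |T - 0|) atTop (𝓝 0) := by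
      have h := (Real.tendsto_exp_neg_atTop_nhds_zero.comp
        ((tendsto_rpow_atTop h0).comp tendsto_abs_atTop_atTop)).mul_const |T - 0|
      rwa [zero_mul] at h
    refine squeeze_zero_norm (fun R => ?_) hlim
    refine intervalIntegral.norm_integral_le_of_norm_le_const fun t ht => ?_
    rw [Set.uIoc_of_le hT] at ht
    rw [hH, norm_mul, Complex.norm_exp]
    have h2 := norm_stableLaplace_add_le h0 h1 ht.1.le (ε R)
    rw [hε] at h2
    refine (mul_le_of_le_one_left (norm_nonneg _) ?_).trans h2
    rw [Real.exp_le_one_iff]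
    simp only [mul_re, ofReal_re, add_re, I_re, mul_zero, ofReal_im, I_im, mul_one, sub_self,
      add_zero, add_im, mul_im, zero_add, zero_mul, sub_zero]
    nlinarith [ht.1]
  have hv : ∀ T' : ℝ, 0 ≤ T' → Tendsto (fun R : ℝ => ∫ y : ℝ in (-R)..R, H ((T' : ℂ) + y * I))
      atTop (𝓝 (∫ y : ℝ, H ((T' : ℂ) + y * I))) := fun T' hT' =>
    intervalIntegral_tendsto_integral (integrable_cexp_mul_stableLaplace h0 h1 x hT')
      tendsto_neg_atTop_atBot tendsto_id
  have hlim := (((hside (fun R => -R) (by simp)).sub (hside (fun R => R) (by simp))).add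
    ((hv T hT).const_smul I)).sub ((hv 0 le_rfl).const_smul I)
  have h := tendsto_nhds_unique (hlim.congr' ((eventually_ge_atTop 0).mono hrect))
    tendsto_const_nhds
  simp only [sub_zero, zero_add, ← smul_sub, smul_eq_zero, I_ne_zero, false_or] at h
  simpa [hH] using (sub_eq_zero.1 h).symm

theorem integral_cexp_mul_stableLaplace_eq_zero {α : ℝ} (h0 : 0 < α) (h1 : α < 1) {x : ℝ}
    (hx : x < 0) : ∫ y : ℝ, cexp (x * (y * I)) * stableLaplace α (y * I) = 0 := by
  rw [← norm_le_zero_iff]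
  have hlim : Tendsto (fun T : ℝ => Real.exp (x * T) * ∫ y : ℝ, Real.exp (-|y| ^ α)) atTop
      (𝓝 0) := by
    rw [← zero_mul (∫ y : ℝ, Real.exp (-|y| ^ α))]
    exact Tendsto.mul_const _ (Real.tendsto_exp_atBot.comp (tendsto_id.const_mul_atTop_of_neg hx))
  refine ge_of_tendsto hlim ((eventually_ge_atTop 0).mono fun T hT => ?_)
  rw [integral_cexp_mul_stableLaplace_shift h0 h1 hx hT, ← integral_const_mul]
  refine norm_integral_le_of_norm_le ((integrable_exp_neg_abs_rpow h0).const_mul _)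
    (Eventually.of_forall fun y => ?_)
  rw [norm_mul, Complex.norm_exp]
  simp only [mul_re, ofReal_re, add_re, I_re, mul_zero, ofReal_im, I_im, mul_one, sub_self,
    add_zero, add_im, mul_im, zero_add, zero_mul, sub_zero]
  exact mul_le_mul_of_nonneg_left (norm_stableLaplace_add_le h0 h1 hT y) (by positivity)

end Contour

/-! ### The law is carried by the positive half-line -/

section Positivity
open Filter Topology Complex FourierTransform SchwartzMap

/-- The integral of a Schwartz function against a probability measure, as the integral of its
Fourier transform against the characteristic function. -/
theorem integral_fourier_eq_integral_mul_charFun (ν : Measure ℝ) [IsProbabilityMeasure ν]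
    {g : ℝ → ℂ} (hg : Integrable g) :
    ∫ x, 𝓕 g x ∂ν = ∫ v, g v * charFun ν (-(2 * Real.pi * v)) := by
  have h := VectorFourier.integral_fourierIntegral_smul_eq_flip (L := innerₗ ℝ) (μ := volume)
    (ν := ν) (f := g) (g := fun _ => (1 : ℂ)) Real.continuous_fourierChar continuous_inner hg
    (integrable_const _)
  simp only [smul_eq_mul, mul_one] at h
  refine Eq.trans h ?_
  congr 1
  ext v
  congr 1
  rw [VectorFourier.fourierIntegral, charFun_apply_real]
  congr 1
  ext x
  simp only [Circle.smul_def, Real.fourierChar_apply, smul_eq_mul, mul_one, LinearMap.flip_apply,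
    innerₗ_apply_apply, RCLike.inner_apply, conj_trivial]
  push_cast
  ring_nf

theorem integral_mul_fourier_eq {f g : ℝ → ℂ} (hf : Integrable f) (hg : Integrable g) :
    ∫ x, 𝓕 f x * g x = ∫ x, f x * 𝓕 g x := by
  have h := VectorFourier.integral_fourierIntegral_smul_eq_flip (L := innerₗ ℝ) (μ := volume)
    (ν := volume) (f := f) (g := g) Real.continuous_fourierChar continuous_inner hf hg
  rw [flip_innerₗ] at h
  exact h

/-- If the characteristic function is integrable, then `ν` is given on Schwartz functions by the
density obtained from Fourier inversion. -/
theorem integral_schwartz_eq_integral_mul_fourier (ν : Measure ℝ) [IsProbabilityMeasure ν]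
    (hν : Integrable fun v : ℝ => charFun ν (2 * Real.pi * v)) (u : 𝓢(ℝ, ℂ)) :
    ∫ x, u x ∂ν = ∫ x, u x * 𝓕 (fun v : ℝ => charFun ν (2 * Real.pi * v)) x := by
  have h1 : (u : ℝ → ℂ) = 𝓕 ((𝓕⁻ u : 𝓢(ℝ, ℂ)) : ℝ → ℂ) := by
    rw [← SchwartzMap.fourier_coe, FourierTransform.fourier_fourierInv_eq]
  have h2 : ∀ v, (𝓕⁻ u : 𝓢(ℝ, ℂ)) v = 𝓕 (u : ℝ → ℂ) (-v) := fun v => by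
    rw [SchwartzMap.fourierInv_coe, Real.fourierInv_eq_fourier_neg]
  conv_lhs => rw [h1]
  rw [integral_fourier_eq_integral_mul_charFun ν (SchwartzMap.integrable _),
    ← integral_mul_fourier_eq u.integrable hν]
  simp_rw [h2]
  -- Both sides now pair the Fourier transform of u with the characteristic function, up to the
  -- reflection v ↦ -v.
  rw [← integral_neg_eq_self]
  simp

/-- The density of `S(α,1,1)` obtained from Fourier inversion vanishes on the negative half-line. -/
theorem IsSkewedStable.fourier_charFun_eq_zero {α : ℝ} (h0 : 0 < α) (h1 : α < 1) {ν : Measure ℝ}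
    (hν : IsSkewedStable α ν) {x : ℝ} (hx : x < 0) :
    𝓕 (fun v : ℝ => charFun ν (2 * Real.pi * v)) x = 0 := by
  have hc : ∀ l, charFun ν l = stableLaplace α (-(l * I)) := fun l => by
    rw [hν.charFun_eq, stableLaplace_neg_mul_I h0 h1]
  rw [Real.fourier_real_eq_integral_exp_smul]
  have h := Measure.integral_comp_mul_left
    (fun y : ℝ => cexp (x * (y * I)) * stableLaplace α (y * I)) (-(2 * Real.pi))
  rw [integral_cexp_mul_stableLaplace_eq_zero h0 h1 hx, smul_zero] at h
  rw [← h]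
  congr 1
  ext v
  rw [hc, smul_eq_mul]
  push_cast
  ring_nf

theorem IsSkewedStable.integrable_charFun {α : ℝ} (h0 : 0 < α) (h1 : α < 1) {ν : Measure ℝ}
    (hν : IsSkewedStable α ν) : Integrable fun v : ℝ => charFun ν (2 * Real.pi * v) := by
  have hi : Integrable (charFun ν) := by
    have h := (integrable_cexp_mul_stableLaplace h0 h1 0 le_rfl).comp_neg
    refine h.congr (Eventually.of_forall fun l => ?_)
    simp only [hν.charFun_eq, ← stableLaplace_neg_mul_I h0 h1]
    simp
  exact hi.comp_mul_left' (by positivity)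

/-- Bump functions serve as test functions for the density. The density vanishes on the negative
half-line, and being bounded it leaves no atom at 0. -/
theorem IsSkewedStable.ae_pos {α : ℝ} (h0 : 0 < α) (h1 : α < 1) {ν : Measure ℝ}
    (hν : IsSkewedStable α ν) : ∀ᵐ x ∂ν, 0 < x := by
  have := hν.isProbabilityMeasure
  set k : ℝ → ℂ := 𝓕 (fun v : ℝ => charFun ν (2 * Real.pi * v)) with hk
  set C : ℝ := ∫ v : ℝ, ‖charFun ν (2 * Real.pi * v)‖ with hC
  have hkC : ∀ x, ‖k x‖ ≤ C := fun x =>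
    VectorFourier.norm_fourierIntegral_le_integral_norm _ _ _ _ _
  have key : ∀ {c : ℝ} (b : ContDiffBump c), ((∫ x, b x ∂ν : ℝ) : ℂ) = ∫ x, (b x : ℂ) * k x := by
    intro c b
    have h2 : HasCompactSupport fun x => (b x : ℂ) := b.hasCompactSupport.comp_left ofReal_zero
    have h3 : ContDiff ℝ (⊤ : ℕ∞) fun x => (b x : ℂ) := ofRealCLM.contDiff.comp b.contDiff
    have := integral_schwartz_eq_integral_mul_fourier ν (hν.integrable_charFun h0 h1)
      (h2.toSchwartzMap h3)
    rw [← integral_complex_ofReal]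
    exact this
  have hball : ∀ {c : ℝ} (b : ContDiffBump c), ν.real (Metric.closedBall c b.rIn) ≤
      ∫ x, b x ∂ν := by
    intro c b
    rw [← integral_indicator_one Metric.isClosed_closedBall.measurableSet]
    refine integral_mono_of_nonneg (Eventually.of_forall fun x => ?_) ?_
      (Eventually.of_forall fun x => ?_)
    · exact Set.indicator_nonneg (fun _ _ => zero_le_one) _
    · exact b.continuous.integrable_of_hasCompactSupport b.hasCompactSupport
    · by_cases hx : x ∈ Metric.closedBall c b.rIn
      · simp [hx, b.one_of_mem_closedBall hx]
      · simp [hx, b.nonneg]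
  have hneg : ν (Set.Iio 0) = 0 := by
    refine measure_null_of_locally_null _ fun c hc => ?_
    have hc : c < 0 := hc
    -- The outer radius -c/2 keeps the support inside the negative half-line.
    let b : ContDiffBump c := ⟨-c / 4, -c / 2, by linarith, by linarith⟩
    refine ⟨Metric.closedBall c b.rIn,
      mem_nhdsWithin_of_mem_nhds (Metric.closedBall_mem_nhds _ b.rIn_pos), ?_⟩
    have h0' : ((∫ x, b x ∂ν : ℝ) : ℂ) = 0 := by
      rw [key b]
      refine integral_eq_zero_of_ae (Eventually.of_forall fun x => ?_)
      rcases lt_or_ge x 0 with hx | hx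
      · simp [hk, hν.fourier_charFun_eq_zero h0 h1 hx]
      · have : b x = 0 := b.zero_of_le_dist (by
          change -c / 2 ≤ dist x c
          rw [Real.dist_eq, abs_of_nonneg (by linarith)]
          linarith)
        simp [this]
    have h := hball b
    rw [ofReal_eq_zero.1 h0'] at h
    rw [← measureReal_eq_zero_iff]
    exact le_antisymm h measureReal_nonneg
  have hzero : ν {0} = 0 := by
    rw [← measureReal_eq_zero_iff]
    refine le_antisymm ?_ measureReal_nonneg
    -- C bounds the density and 4r is the length of the ball of radius 2r supporting the bump.
    have hlim : Tendsto (fun r : ℝ => C * (4 * r)) (𝓝[>] 0) (𝓝 0) := by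
      have : Tendsto (fun r : ℝ => C * (4 * r)) (𝓝 0) (𝓝 (C * (4 * 0))) := by
        apply Continuous.tendsto; fun_prop
      simpa using this.mono_left nhdsWithin_le_nhds
    refine ge_of_tendsto hlim (eventually_mem_nhdsWithin.mono fun r hr => ?_)
    have hr : 0 < r := hr
    let b : ContDiffBump (0 : ℝ) := ⟨r, 2 * r, hr, by linarith⟩
    calc ν.real {0} ≤ ν.real (Metric.closedBall 0 b.rIn) :=
          measureReal_mono (by simpa using b.rIn_pos.le)
      _ ≤ ∫ x, b x ∂ν := hball b
      _ ≤ ‖((∫ x, b x ∂ν : ℝ) : ℂ)‖ := by rw [norm_real]; exact Real.le_norm_self _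
      _ = ‖∫ x in Metric.ball 0 (2 * r), (b x : ℂ) * k x‖ := by
          rw [key b, setIntegral_eq_integral_of_forall_compl_eq_zero]
          intro x hx
          have : b x = 0 := b.zero_of_le_dist (by simpa using hx)
          simp [this]
      _ ≤ C * volume.real (Metric.ball (0 : ℝ) (2 * r)) := by
          refine norm_setIntegral_le_of_norm_le_const measure_ball_lt_top fun x _ => ?_
          rw [norm_mul, norm_real, Real.norm_of_nonneg b.nonneg]
          exact (mul_le_of_le_one_left (norm_nonneg _) b.le_one).trans (hkC x)
      _ = C * (4 * r) := by
          rw [measureReal_def, Real.volume_ball, ENNReal.toReal_ofReal (by positivity)]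
          ring
  rw [ae_iff]
  simp only [not_lt]
  rw [show {a : ℝ | a ≤ 0} = Set.Iio 0 ∪ {0} by ext; simp [le_iff_lt_or_eq]]
  exact measure_union_null hneg hzero

end Positivity

/-! ### Stability under nonnegative combinations -/

section Scaling

/-- The exponent of the characteristic function of `S(α,1,1)`. -/
noncomputable def stableExponent (α l : ℝ) : ℂ :=
  ((|l| ^ α : ℝ) : ℂ) *
    (1 - ((SignType.sign l : ℝ) : ℂ) * Complex.I * ((Real.tan (Real.pi * α / 2) : ℝ) : ℂ))

/-- The exponent is homogeneous of degree α in a nonnegative scale. Products of characteristic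
functions thus add the c_t^α, which is where the ℓ^α expression for θ_i comes from. -/
theorem IsSkewedStable.charFun_mul {α : ℝ} (h0 : 0 < α) {ν : Measure ℝ} (hν : IsSkewedStable α ν)
    {c : ℝ} (hc : 0 ≤ c) (l : ℝ) :
    charFun ν (c * l) = Complex.exp (-((c ^ α : ℝ) : ℂ) * stableExponent α l) := by
  rw [hν.charFun_eq, stableExponent]
  rcases hc.eq_or_lt with rfl | hc'
  · simp [h0.ne']
  · rw [abs_mul, abs_of_pos hc', Real.mul_rpow hc (abs_nonneg _), sign_mul, sign_pos hc', one_mul]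
    push_cast
    ring_nf

/-- A combination, with nonnegative coefficients, of independent `S(α,1,1)` variables is
`S(α,1,1)`-distributed up to scaling. -/
theorem map_sum_eq_map_mul {α : ℝ} (h0 : 0 < α) {Ω ι : Type*} [MeasurableSpace Ω] {P : Measure Ω}
    {ν : Measure ℝ} (hν : IsSkewedStable α ν) {X : ι → Ω → ℝ} (hX : ∀ t, AEMeasurable (X t) P)
    (hlaw : ∀ t, P.map (X t) = ν) (hind : iIndepFun X P) {c : ι → ℝ} (T : Finset ι)
    (hc : ∀ t ∈ T, 0 ≤ c t) :
    P.map (fun ω => ∑ t ∈ T, c t * X t ω) =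
      ν.map ((∑ t ∈ T, c t ^ α) ^ (1 / α) * ·) := by
  have := hν.isProbabilityMeasure
  have := hind.isProbabilityMeasure
  have hi : iIndepFun (fun t ω => c t * X t ω) P :=
    hind.comp (fun t x => c t * x) fun t => by fun_prop
  have hm : ∀ t, AEMeasurable (fun ω => c t * X t ω) P := fun t => (hX t).const_mul _
  have h1 : IsProbabilityMeasure (P.map (fun ω => ∑ t ∈ T, c t * X t ω)) :=
    Measure.isProbabilityMeasure_map (by fun_prop)
  have h2 : IsProbabilityMeasure (ν.map ((∑ t ∈ T, c t ^ α) ^ (1 / α) * ·)) :=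
    Measure.isProbabilityMeasure_map (by fun_prop)
  have hs : 0 ≤ ∑ t ∈ T, c t ^ α := Finset.sum_nonneg fun t ht => Real.rpow_nonneg (hc t ht) _
  refine Measure.ext_of_charFun ?_
  funext l
  rw [(hi.restrict _).charFun_map_fun_finsetSum_eq_prod (fun t _ => hm t), Finset.prod_apply,
    charFun_map_mul, hν.charFun_mul h0 (Real.rpow_nonneg hs _), ← Real.rpow_mul hs,
    one_div_mul_cancel h0.ne', Real.rpow_one]
  push_cast
  rw [← Finset.sum_neg_distrib, Finset.sum_mul, Complex.exp_sum]
  refine Finset.prod_congr rfl fun t ht => ?_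
  rw [charFun_map_mul_comp (hX t), hlaw, hν.charFun_mul h0 (hc t ht)]

end Scaling

/-! ### Independence of the columns -/

section Columns

/-- Events that are determined in the same way by the different columns of an array of independent
variables are independent. -/
theorem measure_biInter_columns {Ω ι κ : Type*} [Fintype ι] [Countable κ] [MeasurableSpace Ω]
    {P : Measure Ω}
    {s : ι → κ → Ω → ℝ} (hs : ∀ i j, AEMeasurable (s i j) P)
    (hind : iIndepFun (fun p : ι × κ => s p.1 p.2) P) {B : Set (ι → ℝ)} (hB : MeasurableSet B)
    (T : Finset κ) :
    P (⋂ j ∈ T, {ω | (fun i => s i j ω) ∈ B}) = ∏ j ∈ T, P {ω | (fun i => s i j ω) ∈ B} := by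
  classical
  have := hind.isProbabilityMeasure
  induction T using Finset.induction with
  | empty => simp
  | insert j T hj ih =>
    rw [Finset.set_biInter_insert, Finset.prod_insert hj, ← ih]
    -- Column j and the columns in T occupy disjoint index blocks, so the events they determine are
    -- independent.
    have hd : Disjoint (Finset.univ ×ˢ {j} : Finset (ι × κ)) (Finset.univ ×ˢ T) := by
      rw [Finset.disjoint_product]
      right
      simpa using hj
    have h := hind.indepFun_finset₀ _ _ hd fun p => hs p.1 p.2
    have h' := h.measure_inter_preimage_eq_mul
      {v | (fun i => v ⟨(i, j), by simp⟩) ∈ B}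
      {v | ∀ k (hk : k ∈ T), (fun i => v ⟨(i, k), by simpa using hk⟩) ∈ B} ?_ ?_
    · convert h' using 3 <;> ext <;> simp
    · exact (by fun_prop : Measurable fun (v : ↥(Finset.univ ×ˢ {j} : Finset (ι × κ)) → ℝ) i =>
        v ⟨(i, j), _⟩) hB
    · rw [Set.ofPred_forall]
      refine MeasurableSet.iInter fun k => ?_
      by_cases hk : k ∈ T
      · simp only [hk, forall_true_left]
        exact (by fun_prop : Measurable fun (v : ↥(Finset.univ ×ˢ T : Finset (ι × κ)) → ℝ) i =>
          v ⟨(i, k), _⟩) hB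
      · simp [hk]

end Columns

/-! ### The bias constant as an integral of tails -/

section Tail

theorem IsSkewedStable.ae_prod_pos {α : ℝ} (h0 : 0 < α) (h1 : α < 1) {ν : Measure ℝ}
    (hν : IsSkewedStable α ν) : ∀ᵐ p ∂ν.prod ν, 0 < p.1 ∧ 0 < p.2 := by
  have := hν.isProbabilityMeasure
  exact (Measure.quasiMeasurePreserving_fst.ae (hν.ae_pos h0 h1)).and
    (Measure.quasiMeasurePreserving_snd.ae (hν.ae_pos h0 h1))

/-- Almost surely the ratio is positive, where r ↦ r^(α/(1-α)) is strictly increasing, so the two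
powers cancel. -/
theorem IsSkewedStable.one_sub_ratioCDF {α : ℝ} (h0 : 0 < α) (h1 : α < 1) {ν : Measure ℝ}
    (hν : IsSkewedStable α ν) {u : ℝ} (hu : 0 < u) :
    1 - ratioCDF α (u ^ (α / (1 - α))) = (ν.prod ν).real {p | u < p.2 / p.1} := by
  have := hν.isProbabilityMeasure
  rw [ratioCDF, ← hν.eq_skewedStable, ← probReal_compl_eq_one_sub
    (measurableSet_le (by fun_prop) (by fun_prop))]
  refine measureReal_congr ?_
  filter_upwards [hν.ae_prod_pos h0 h1] with p hp
  have hq : 0 < α / (1 - α) := div_pos h0 (by linarith)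
  simp only [Set.compl_ofPred, not_le, eq_iff_iff]
  exact Real.rpow_lt_rpow_iff hu.le (div_nonneg hp.2.le hp.1.le) hq

theorem IsSkewedStable.biasConst_eq {α : ℝ} (h0 : 0 < α) (h1 : α < 1) {ν : Measure ℝ}
    (hν : IsSkewedStable α ν) (M : ℕ) :
    biasConst M α = ∫⁻ u in Set.Ioi (0 : ℝ), (ν.prod ν) {p | u < p.2 / p.1} ^ M := by
  have := hν.isProbabilityMeasure
  refine setLIntegral_congr_fun measurableSet_Ioi fun u hu => ?_
  rw [hν.one_sub_ratioCDF h0 h1 hu, ENNReal.ofReal_pow measureReal_nonneg, ofReal_measureReal]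

theorem lintegral_Ioi_comp_div {f : ℝ → ENNReal} {c : ℝ} (hc : 0 < c) :
    ∫⁻ u in Set.Ioi (0 : ℝ), f (u / c) = ENNReal.ofReal c * ∫⁻ u in Set.Ioi (0 : ℝ), f u := by
  have h := lintegral_image_eq_lintegral_abs_deriv_mul (s := Set.Ioi (0 : ℝ)) (f := fun u => c * u)
    (f' := fun _ => c) measurableSet_Ioi
    (fun u _ => by simpa using ((hasDerivAt_id u).const_mul c).hasDerivWithinAt)
    (fun u _ v _ huv => mul_left_cancel₀ hc.ne' huv) (fun u => f (u / c))
  rw [Set.image_mul_left_Ioi hc, mul_zero] at h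
  rw [h, abs_of_pos hc, lintegral_const_mul' _ _ ENNReal.ofReal_ne_top]
  simp [mul_div_cancel_left₀ _ hc.ne']

theorem IsSkewedStable.lintegral_tail_eq {α : ℝ} (h0 : 0 < α) (h1 : α < 1) {ν : Measure ℝ}
    (hν : IsSkewedStable α ν) {M : ℕ} (hM : 1 ≤ M) {θ : ℝ} (hθ : 0 ≤ θ) :
    ∫⁻ u in Set.Ioi (0 : ℝ), (ν.prod ν) {p | u < θ * p.2 / p.1} ^ M =
      ENNReal.ofReal θ * biasConst M α := by
  rcases hθ.eq_or_lt with rfl | hθ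
  · rw [ENNReal.ofReal_zero, zero_mul, ← lintegral_zero]
    refine setLIntegral_congr_fun measurableSet_Ioi fun u hu => ?_
    have : {p : ℝ × ℝ | u < 0 * p.2 / p.1} = ∅ := by
      ext p; simpa using (Set.mem_Ioi.1 hu).le
    simp only [this]
    -- Here M ≥ 1 matters: 0^M = 0, in agreement with 0 · ∞ = 0 when the constant is infinite.
    simp; omega
  · rw [hν.biasConst_eq h0 h1, ← lintegral_Ioi_comp_div hθ]
    simp_rw [div_lt_iff₀' hθ, mul_div_assoc]

end Tail

/-! ### Expectation of the minimum estimator -/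

section Estimator

variable {α : ℝ} {Ω : Type*} [MeasurableSpace Ω] {P : Measure Ω} {N M : ℕ}
  {x : Fin N → ℝ} {s : Fin N → Fin M → Ω → ℝ}

theorem measure_lt_interference_ratio (h0 : 0 < α) (hx : ∀ i, 0 ≤ x i)
    (hs : ∀ i j, AEMeasurable (s i j) P) {ν : Measure ℝ} (hν : IsSkewedStable α ν)
    (hlaw : ∀ i j, P.map (s i j) = ν)
    (hind : iIndepFun (fun p : Fin N × Fin M => s p.1 p.2) P) (i : Fin N) (j : Fin M) (u : ℝ) :
    P {ω | u < (∑ t ∈ Finset.univ.erase i, x t * s t j ω) / s i j ω} =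
      (ν.prod ν) {p | u < thetaOther α x i * p.2 / p.1} := by
  have := hν.isProbabilityMeasure
  have hprob := hind.isProbabilityMeasure
  have hcol : iIndepFun (fun t => s t j) P :=
    hind.precomp (g := fun t => (t, j)) fun a b h => (Prod.mk.inj h).1
  -- Coefficient 1 at i makes the i-th member of the rescaled family s_ij itself, so that it is
  -- independent of the sum of the other members.
  set c : Fin N → ℝ := Function.update x i 1
  have hi : iIndepFun (fun t ω => c t * s t j ω) P :=
    hcol.comp (fun t y => c t * y) fun t => by fun_prop
  have hm : ∀ t, AEMeasurable (fun ω => c t * s t j ω) P := fun t => (hs t j).const_mul _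
  have h := hi.indepFun_finsetSum_of_notMem₀ hm (Finset.notMem_erase i Finset.univ)
  have hsum : (∑ t ∈ Finset.univ.erase i, fun ω => c t * s t j ω) =
      fun ω => ∑ t ∈ Finset.univ.erase i, x t * s t j ω := by
    ext ω
    rw [Finset.sum_apply]
    refine Finset.sum_congr rfl fun t ht => ?_
    simp [c, Function.update_of_ne (Finset.ne_of_mem_erase ht)]
  have hci : (fun ω => c i * s i j ω) = s i j := by
    ext ω; simp [c]
  rw [hsum, hci] at h
  have hU : AEMeasurable (fun ω => ∑ t ∈ Finset.univ.erase i, x t * s t j ω) P := by fun_prop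
  have hmap := (indepFun_iff_map_prod_eq_prod_map_map (hs i j) hU).1 h.symm
  rw [hlaw, map_sum_eq_map_mul h0 hν (fun t => hs t j) (fun t => hlaw t j) hcol _
    (fun t _ => hx t)] at hmap
  have hB : MeasurableSet {p : ℝ × ℝ | u < p.2 / p.1} :=
    measurableSet_lt (by fun_prop) (by fun_prop)
  have e1 : P {ω | u < (∑ t ∈ Finset.univ.erase i, x t * s t j ω) / s i j ω} =
      (P.map fun ω => (s i j ω, ∑ t ∈ Finset.univ.erase i, x t * s t j ω))
        {p : ℝ × ℝ | u < p.2 / p.1} := by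
    rw [Measure.map_apply_of_aemeasurable ((hs i j).prodMk hU) hB]
    rfl
  rw [e1, hmap]
  -- Writing the first factor as the image of ν under the identity exhibits the product as an image
  -- of `ν.prod ν`.
  conv_lhs => rw [← Measure.map_id (μ := ν), Measure.map_map (by fun_prop) measurable_id,
    Measure.map_prod_map _ _ measurable_id (by fun_prop),
    Measure.map_apply (by fun_prop) hB]
  rfl

theorem ae_minEstimator_eq (h0 : 0 < α) (h1 : α < 1) (hM : 1 ≤ M)
    (hs : ∀ i j, AEMeasurable (s i j) P) {ν : Measure ℝ} (hν : IsSkewedStable α ν)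
    (hlaw : ∀ i j, P.map (s i j) = ν) (i : Fin N) :
    ∀ᵐ ω ∂P, (∀ t j, 0 < s t j ω) ∧ minEstimator x (fun t j => s t j ω) i =
      x i + ⨅ j, (∑ t ∈ Finset.univ.erase i, x t * s t j ω) / s i j ω := by
  have hne : Nonempty (Fin M) := ⟨⟨0, hM⟩⟩
  have hpos : ∀ᵐ ω ∂P, ∀ t j, 0 < s t j ω := by
    rw [ae_all_iff]; intro t
    rw [ae_all_iff]; intro j
    refine ae_of_ae_map (p := fun y => 0 < y) (hs t j) ?_
    rw [hlaw]
    exact hν.ae_pos h0 h1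
  filter_upwards [hpos] with ω hω
  refine ⟨hω, ?_⟩
  rw [minEstimator, add_ciInf (Set.finite_range _).bddBelow]
  congr 1
  ext j
  rw [measurement, ← Finset.add_sum_erase _ _ (Finset.mem_univ i), add_div,
    mul_div_cancel_right₀ _ (hω i j).ne']

theorem le_minEstimator_and_lintegral (h0 : 0 < α) (h1 : α < 1) (hM : 1 ≤ M)
    (hx : ∀ i, 0 ≤ x i) (hs : ∀ i j, AEMeasurable (s i j) P) {ν : Measure ℝ}
    (hν : IsSkewedStable α ν) (hlaw : ∀ i j, P.map (s i j) = ν)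
    (hind : iIndepFun (fun p : Fin N × Fin M => s p.1 p.2) P) (i : Fin N) :
    (∀ᵐ ω ∂P, x i ≤ minEstimator x (fun t j => s t j ω) i) ∧
      ∫⁻ ω, ENNReal.ofReal (minEstimator x (fun t j => s t j ω) i) ∂P
        = ENNReal.ofReal (x i) + ENNReal.ofReal (thetaOther α x i) * biasConst M α := by
  have hprob := hind.isProbabilityMeasure
  have hne : Nonempty (Fin M) := ⟨⟨0, hM⟩⟩
  have hmin := ae_minEstimator_eq (x := x) h0 h1 hM hs hν hlaw i
  set R : Ω → ℝ := fun ω => ⨅ j, (∑ t ∈ Finset.univ.erase i, x t * s t j ω) / s i j ω with hR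
  have hRm : AEMeasurable R P := by
    refine AEMeasurable.iInf fun j => ?_
    have := hs i j
    fun_prop
  have hR0 : ∀ᵐ ω ∂P, 0 ≤ R ω := by
    filter_upwards [hmin] with ω hω
    exact le_ciInf fun j => div_nonneg
      (Finset.sum_nonneg fun t _ => mul_nonneg (hx t) (hω.1 t j).le) (hω.1 i j).le
  constructor
  · filter_upwards [hmin, hR0] with ω hω h
    rw [hω.2]
    linarith
  have hθ : 0 ≤ thetaOther α x i :=
    Real.rpow_nonneg (Finset.sum_nonneg fun t _ => Real.rpow_nonneg (hx t) _) _
  calc ∫⁻ ω, ENNReal.ofReal (minEstimator x (fun t j => s t j ω) i) ∂P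
      = ∫⁻ ω, (ENNReal.ofReal (x i) + ENNReal.ofReal (R ω)) ∂P := by
        refine lintegral_congr_ae ?_
        filter_upwards [hmin, hR0] with ω hω h
        rw [hω.2, ENNReal.ofReal_add (hx i) h]
    _ = ENNReal.ofReal (x i) + ∫⁻ u in Set.Ioi (0 : ℝ), P {ω | u < R ω} := by
        rw [lintegral_add_left measurable_const, lintegral_eq_lintegral_meas_lt P hR0 hRm]
        simp
    _ = _ := by
        rw [← hν.lintegral_tail_eq h0 h1 hM hθ]
        congr 2
        ext u
        have hB : MeasurableSet {v : Fin N → ℝ |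
            u < (∑ t ∈ Finset.univ.erase i, x t * v t) / v i} :=
          measurableSet_lt (by fun_prop) (by fun_prop)
        have h := measure_biInter_columns hs hind hB Finset.univ
        simp only [Set.mem_ofPred_eq, measure_lt_interference_ratio h0 hx hs hν hlaw hind,
          Finset.prod_const, Finset.card_univ, Fintype.card_fin] at h
        rw [← h]
        congr 1
        ext ω
        simp only [Set.mem_ofPred_eq, hR, Finset.mem_univ, Set.iInter_true, Set.mem_iInter]
        -- The infimum is over a finite nonempty set, hence attained, so the strict inequality
        -- passes to all columns.
        rw [← Set.forall_mem_range (p := fun y => u < y)]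
        exact Set.Finite.lt_csInf_iff (Set.finite_range _) (Set.range_nonempty _)

theorem minEstimator_expectation (h0 : 0 < α) (h1 : α < 1) (hM : 1 ≤ M)
    (hx : ∀ i, 0 ≤ x i) (hs : ∀ i j, AEMeasurable (s i j) P)
    (hstab : ∀ i j, IsSkewedStable α (P.map (s i j)))
    (hind : iIndepFun (fun p : Fin N × Fin M => s p.1 p.2) P) (i : Fin N) :
    (∀ᵐ ω ∂P, x i ≤ minEstimator x (fun t j => s t j ω) i) ∧
      ∫⁻ ω, ENNReal.ofReal (minEstimator x (fun t j => s t j ω) i) ∂P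
        = ENNReal.ofReal (x i) + ENNReal.ofReal (thetaOther α x i) * biasConst M α ∧
      (biasConst M α ≠ ⊤ →
        Integrable (fun ω => minEstimator x (fun t j => s t j ω) i) P ∧
        ∫ ω, minEstimator x (fun t j => s t j ω) i ∂P
          = x i + thetaOther α x i * (biasConst M α).toReal) := by
  have hν : IsSkewedStable α (P.map (s i ⟨0, hM⟩)) := hstab _ _
  have hlaw : ∀ t j, P.map (s t j) = P.map (s i ⟨0, hM⟩) := fun t j => (hstab t j).unique hν
  obtain ⟨hle, hint⟩ := le_minEstimator_and_lintegral h0 h1 hM hx hs hν hlaw hind i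
  refine ⟨hle, hint, fun hfin => ?_⟩
  have hθ : 0 ≤ thetaOther α x i :=
    Real.rpow_nonneg (Finset.sum_nonneg fun t _ => Real.rpow_nonneg (hx t) _) _
  have hnn : 0 ≤ᵐ[P] fun ω => minEstimator x (fun t j => s t j ω) i :=
    hle.mono fun ω h => (hx i).trans h
  have hmeas : AEMeasurable (fun ω => minEstimator x (fun t j => s t j ω) i) P := by
    refine AEMeasurable.iInf fun j => ?_
    have := hs i j
    unfold measurement
    fun_prop
  have hne : ENNReal.ofReal (thetaOther α x i) * biasConst M α ≠ ⊤ :=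
    ENNReal.mul_ne_top ENNReal.ofReal_ne_top hfin
  constructor
  · refine (lintegral_ofReal_ne_top_iff_integrable hmeas.aestronglyMeasurable hnn).1 ?_
    rw [hint]
    exact ENNReal.add_ne_top.2 ⟨ENNReal.ofReal_ne_top, hne⟩
  · rw [integral_eq_lintegral_of_nonneg_ae hnn hmeas.aestronglyMeasurable, hint,
      ENNReal.toReal_add ENNReal.ofReal_ne_top hne, ENNReal.toReal_mul,
      ENNReal.toReal_ofReal (hx i), ENNReal.toReal_ofReal hθ]

end Estimator

/-! ### A Gaussian integral -/

section CauchySchloemilch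
open Real

/-- The Cauchy–Schlömilch substitution for the Gaussian integral. -/
theorem integral_Ioi_exp_neg_sq_add_inv_sq {b : ℝ} (hb : 0 < b) :
    ∫ z in Set.Ioi (0 : ℝ), exp (-(z ^ 2 + b ^ 2 / z ^ 2) / 2) = √(π / 2) * exp (-b) := by
  -- g y is the positive root of z² - yz - b = 0, so g inverts z ↦ z - b/z and z² + b²/z² = y² + 2b.
  set r : ℝ → ℝ := fun y => √(y ^ 2 + 4 * b) with hr
  set g : ℝ → ℝ := fun y => (y + r y) / 2 with hg
  have hpos : ∀ y, 0 < y ^ 2 + 4 * b := fun y => by positivity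
  have hr0 : ∀ y, 0 < r y := fun y => sqrt_pos.2 (hpos y)
  have hr2 : ∀ y, r y ^ 2 = y ^ 2 + 4 * b := fun y => sq_sqrt (hpos y).le
  have hyr : ∀ y, |y| ≤ r y := fun y => by
    rw [← sqrt_sq_eq_abs]; exact sqrt_le_sqrt (by linarith)
  have hg0 : ∀ y, 0 < g y := fun y => by
    have h1 : |y| < r y := by
      rw [← sqrt_sq_eq_abs]; exact sqrt_lt_sqrt (sq_nonneg y) (by linarith)
    have := neg_abs_le y
    simp only [hg]; linarith
  have hgq : ∀ y, g y ^ 2 = y * g y + b := fun y => by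
    have := hr2 y
    simp only [hg]; nlinarith
  have hgy : ∀ y, g y - b / g y = y := fun y => by
    have := hgq y
    have := (hg0 y).ne'
    field_simp
    linarith
  have hder : ∀ y, HasDerivAt g ((1 + y / r y) / 2) y := fun y => by
    have h1 : HasDerivAt (fun y : ℝ => y ^ 2 + 4 * b) (2 * y) y := by
      simpa using (hasDerivAt_pow 2 y).add_const (4 * b)
    have h2 := ((hasDerivAt_id y).add (h1.sqrt (hpos y).ne')).div_const 2
    refine h2.congr_deriv ?_
    simp only [hr]
    have := (hr0 y).ne'
    field_simp
  have himg : g '' Set.univ = Set.Ioi 0 := by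
    ext z
    simp only [Set.image_univ, Set.mem_range, Set.mem_Ioi]
    refine ⟨fun ⟨y, hy⟩ => hy ▸ hg0 y, fun hz => ⟨z - b / z, ?_⟩⟩
    have h : r (z - b / z) = z + b / z := by
      simp only [hr]
      rw [show (z - b / z) ^ 2 + 4 * b = (z + b / z) ^ 2 by field_simp; ring]
      exact sqrt_sq (by positivity)
    simp only [hg, h]
    ring
  have hinj : Set.InjOn g Set.univ := fun y _ y' _ h => by
    rw [← hgy y, ← hgy y', h]
  have h := integral_image_eq_integral_abs_deriv_smul MeasurableSet.univ
    (fun y _ => (hder y).hasDerivWithinAt) hinj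
    (fun z => exp (-(z ^ 2 + b ^ 2 / z ^ 2) / 2))
  rw [himg, setIntegral_univ] at h
  rw [h]
  have hexp : ∀ y, exp (-(g y ^ 2 + b ^ 2 / g y ^ 2) / 2) = exp (-b) * exp (-(1 / 2) * y ^ 2) :=
    fun y => by
      rw [← exp_add]
      congr 1
      have := (hg0 y).ne'
      have h2 : y ^ 2 = g y ^ 2 + b ^ 2 / g y ^ 2 - 2 * b := by
        conv_lhs => rw [← hgy y]
        field_simp
        ring
      rw [h2]
      ring
  have hle : ∀ y, |y / r y| ≤ 1 := fun y => by
    rw [abs_div, abs_of_pos (hr0 y)]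
    exact (div_le_one (hr0 y)).2 (hyr y)
  have hint : Integrable fun y : ℝ => exp (-(1 / 2) * y ^ 2) :=
    integrable_exp_neg_mul_sq (by norm_num)
  have hint2 : Integrable fun y : ℝ => y / r y * exp (-(1 / 2) * y ^ 2) := by
    refine hint.bdd_mul (c := 1) ?_ (Filter.Eventually.of_forall fun y => hle y)
    exact Continuous.aestronglyMeasurable
      (Continuous.div continuous_id (by fun_prop) fun y => (hr0 y).ne')
  -- The Jacobian is 1/2 plus an odd function of y; only the constant part contributes.
  have hodd : ∫ y : ℝ, y / r y * exp (-(1 / 2) * y ^ 2) = 0 := by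
    have h := integral_neg_eq_self (fun y : ℝ => y / r y * exp (-(1 / 2) * y ^ 2)) volume
    have h2 : ∀ y : ℝ, -y / r (-y) * exp (-(1 / 2) * (-y) ^ 2) =
        -(y / r y * exp (-(1 / 2) * y ^ 2)) := fun y => by
      simp only [hr, neg_sq]; ring
    simp only [h2, integral_neg] at h
    linarith
  calc ∫ y, |(1 + y / r y) / 2| • exp (-(g y ^ 2 + b ^ 2 / g y ^ 2) / 2)
      = ∫ y, (exp (-b) / 2 * exp (-(1 / 2) * y ^ 2) +
          exp (-b) / 2 * (y / r y * exp (-(1 / 2) * y ^ 2))) := by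
        congr 1
        ext y
        rw [hexp, abs_of_nonneg (by linarith [neg_le_of_abs_le (hle y)]), smul_eq_mul]
        ring
    _ = √(π / 2) * exp (-b) := by
        rw [integral_add (hint.const_mul _) (hint2.const_mul _), integral_const_mul,
          integral_const_mul, hodd, integral_gaussian,
          show π / (1 / 2) = 2 ^ 2 * (π / 2) by ring, sqrt_mul (by norm_num),
          sqrt_sq (by norm_num)]
        ring

end CauchySchloemilch

/-! ### The law for α = 1/2 from a Gaussian -/

section Levy
open Filter Topology Complex

theorem mgf_neg_inv_sq_gaussianReal {l : ℝ} (hl : 0 < l) :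
    mgf (fun z : ℝ => -(1 / z ^ 2)) (gaussianReal 0 1) l = Real.exp (-√(2 * l)) := by
  rw [mgf, integral_gaussianReal_eq_integral_smul one_ne_zero]
  have hb : 0 < √(2 * l) := Real.sqrt_pos.2 (by positivity)
  have h := integral_comp_abs (f := fun z : ℝ =>
    (√(2 * Real.pi))⁻¹ * Real.exp (-(z ^ 2 + √(2 * l) ^ 2 / z ^ 2) / 2))
  rw [integral_const_mul (μ := volume.restrict (Set.Ioi 0)),
    integral_Ioi_exp_neg_sq_add_inv_sq hb] at h
  have hpi : √(2 * Real.pi) = 2 * √(Real.pi / 2) := by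
    rw [show 2 * Real.pi = 2 ^ 2 * (Real.pi / 2) by ring, Real.sqrt_mul (by norm_num),
      Real.sqrt_sq (by norm_num)]
  have hpi0 : √(Real.pi / 2) ≠ 0 := (Real.sqrt_pos.2 (by positivity)).ne'
  refine Eq.trans ?_ (h.trans ?_)
  · congr 1
    ext z
    rw [gaussianPDFReal, smul_eq_mul, sq_abs, Real.sq_sqrt (by positivity), mul_assoc,
      ← Real.exp_add]
    simp only [NNReal.coe_one, mul_one, sub_zero]
    ring_nf
  · rw [hpi]
    field_simp

theorem norm_cexp_mul_neg_inv_sq_le_one {w : ℂ} (hw : 0 ≤ w.re) :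
    ∀ z : ℝ, ‖cexp (w * ((-(1 / z ^ 2) : ℝ) : ℂ))‖ ≤ 1 := by
  intro z
  rw [Complex.norm_exp, Real.exp_le_one_iff, re_mul_ofReal]
  have : 0 ≤ 1 / z ^ 2 := by positivity
  nlinarith

/-- Both sides are holomorphic on Re w > 0 and agree on the positive reals, hence at points
accumulating at 1; the identity theorem applies. -/
theorem complexMGF_neg_inv_sq_gaussianReal {w : ℂ} (hw : 0 < w.re) :
    complexMGF (fun z : ℝ => -(1 / z ^ 2)) (gaussianReal 0 1) w = stableLaplace (1 / 2) w := by
  set X : ℝ → ℝ := fun z => -(1 / z ^ 2) with hX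
  have hset : Set.Ioi 0 ⊆ interior (integrableExpSet X (gaussianReal 0 1)) := by
    refine interior_maximal (fun l hl => ?_) isOpen_Ioi
    refine Integrable.of_bound (C := 1) (by fun_prop) (Eventually.of_forall fun z => ?_)
    rw [Real.norm_eq_abs, Real.abs_exp, Real.exp_le_one_iff]
    have h1 : 0 ≤ 1 / z ^ 2 := by positivity
    have h2 : 0 < l := hl
    simp only [hX]
    nlinarith
  have hU : IsOpen {w : ℂ | 0 < w.re} := isOpen_lt continuous_const continuous_re
  have h1 : AnalyticOnNhd ℂ (complexMGF X (gaussianReal 0 1)) {w | 0 < w.re} := fun w hw =>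
    analyticAt_complexMGF (hset hw)
  have h2 : AnalyticOnNhd ℂ (stableLaplace (1 / 2)) {w | 0 < w.re} :=
    DifferentiableOn.analyticOnNhd
      (fun w hw => (differentiableAt_stableLaplace hw).differentiableWithinAt) hU
  have hreal : ∀ l : ℝ, 0 < l →
      complexMGF X (gaussianReal 0 1) l = stableLaplace (1 / 2) l := by
    intro l hl
    rw [complexMGF_ofReal, mgf_neg_inv_sq_gaussianReal hl, stableLaplace,
      show Real.pi * (1 / 2) / 2 = Real.pi / 4 by ring, Real.cos_pi_div_four,
      ← ofReal_cpow hl.le, ← Real.sqrt_eq_rpow, ofReal_exp]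
    norm_cast
    rw [Real.sqrt_mul (by norm_num)]
    congr 2
    have h2 : √2 ≠ 0 := by positivity
    field_simp
    rw [Real.sq_sqrt (by norm_num)]
  refine h1.eqOn_of_preconnected_of_frequently_eq h2 (convex_halfSpace_re_gt 0).isPreconnected
    (z₀ := 1) (by simp) ?_ hw
  have ht : Tendsto (fun n : ℕ => ((1 + 1 / ((n : ℝ) + 1) : ℝ) : ℂ)) atTop (𝓝[≠] 1) := by
    refine tendsto_nhdsWithin_iff.2 ⟨?_, Eventually.of_forall fun n => ?_⟩
    · rw [← ofReal_one]
      refine (continuous_ofReal.tendsto _).comp ?_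
      simpa using (tendsto_one_div_add_atTop_nhds_zero_nat (𝕜 := ℝ)).const_add 1
    · have : (1 : ℝ) / ((n : ℝ) + 1) ≠ 0 := by positivity
      simp only [Set.mem_compl_iff, Set.mem_singleton_iff]
      norm_cast
      simpa using this
  exact ht.frequently (Frequently.of_forall fun n => hreal _ (by positivity))

/-- If `Z` is standard Gaussian, then `1 / Z²` has law `S(1/2,1,1)`. -/
theorem isSkewedStable_map_inv_sq_gaussianReal :
    IsSkewedStable (1 / 2) ((gaussianReal 0 1).map fun z => 1 / z ^ 2) := by
  refine ⟨Measure.isProbabilityMeasure_map (by fun_prop), fun l => ?_⟩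
  rw [← stableLaplace_neg_mul_I (by norm_num) (by norm_num), ← complexMGF_mul_I (by fun_prop)]
  -- The imaginary axis is approached from the right; dominated convergence with bound 1 applies on
  -- the Gaussian side.
  set w : ℝ → ℂ := fun ε => ε - l * I with hw
  have hwc : Tendsto w (𝓝[>] 0) (𝓝 (-(l * I))) := by
    have : Continuous w := by fun_prop
    simpa [hw] using (this.tendsto 0).mono_left nhdsWithin_le_nhds
  have h1 : Tendsto (fun ε => stableLaplace (1 / 2) (w ε)) (𝓝[>] 0)
      (𝓝 (stableLaplace (1 / 2) (-(l * I)))) :=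
    (continuousAt_stableLaplace (by norm_num) (by simp)).tendsto.comp hwc
  have h2 : Tendsto (fun ε => complexMGF (fun z : ℝ => -(1 / z ^ 2)) (gaussianReal 0 1) (w ε))
      (𝓝[>] 0) (𝓝 (complexMGF (fun z : ℝ => 1 / z ^ 2) (gaussianReal 0 1) (l * I))) := by
    refine tendsto_integral_filter_of_dominated_convergence (fun _ => 1) ?_ ?_
      (integrable_const _) (Eventually.of_forall fun z => ?_)
    · exact Eventually.of_forall fun ε => by
        have : Measurable fun z : ℝ => -(1 / z ^ 2) := by fun_prop
        exact (by fun_prop : Measurable fun z : ℝ =>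
          cexp (w ε * ((-(1 / z ^ 2) : ℝ) : ℂ))).aestronglyMeasurable
    · filter_upwards [self_mem_nhdsWithin] with ε hε
      refine Eventually.of_forall (norm_cexp_mul_neg_inv_sq_le_one ?_)
      simpa [hw] using (Set.mem_Ioi.1 hε).le
    · have h3 : (l * I : ℂ) * ((1 / z ^ 2 : ℝ) : ℂ) = -(l * I) * ((-(1 / z ^ 2) : ℝ) : ℂ) := by
        push_cast; ring
      rw [h3]
      exact (continuous_exp.tendsto _).comp (hwc.mul_const _)
  refine tendsto_nhds_unique h2 (h1.congr' ?_)
  filter_upwards [self_mem_nhdsWithin] with ε hε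
  rw [complexMGF_neg_inv_sq_gaussianReal (by simpa [hw] using hε)]

end Levy

/-! ### Bernoulli expansion of v cot v -/

section CotSeries
open Real

/-- The function `v cot v`, extended continuously to `0`. -/
noncomputable def mulCot (v : ℝ) : ℝ := cos v / sinc v

theorem sinc_pos_of_mem {v : ℝ} (hv : v ∈ Set.Icc 0 (π / 2)) : 0 < sinc v := by
  have := pi_pos
  rcases hv.1.eq_or_lt with rfl | h
  · simp
  · rw [sinc_of_ne_zero h.ne']
    exact div_pos (sin_pos_of_pos_of_lt_pi h (by linarith [hv.2])) h

theorem continuousOn_mulCot : ContinuousOn mulCot (Set.Icc 0 (π / 2)) :=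
  continuous_cos.continuousOn.div continuous_sinc.continuousOn fun _ hv => (sinc_pos_of_mem hv).ne'

theorem mulCot_of_ne_zero {v : ℝ} (hv : v ≠ 0) : mulCot v = v * (cos v / sin v) := by
  rw [mulCot, sinc_of_ne_zero hv]
  field_simp

/-- This is the Mittag-Leffler expansion of π cot(πx) at x = v/π, multiplied by -v/(2π). -/
theorem hasSum_inv_sq_sub_sq {v : ℝ} (h0 : 0 < v) (h1 : v < π) :
    HasSum (fun n : ℕ => v ^ 2 / (((n + 1 : ℕ) : ℝ) ^ 2 * π ^ 2 - v ^ 2)) ((1 - mulCot v) / 2) := by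
  have hpi := pi_pos
  have hx : ((v / π : ℝ) : ℂ) ∈ Complex.integerComplement := by
    rintro ⟨n, hn⟩
    have hn' : (n : ℝ) = v / π := by exact_mod_cast hn
    have h2 : (0 : ℝ) < n := hn' ▸ div_pos h0 hpi
    have h3 : (n : ℝ) < 1 := hn' ▸ (div_lt_one hpi).2 h1
    have h2' : 0 < n := by exact_mod_cast h2
    have h3' : n < 1 := by exact_mod_cast h3
    omega
  have hs := (summable_cotTerm hx).hasSum
  have e : ∑' n, cotTerm ((v / π : ℝ) : ℂ) n =
      π * Complex.cot (π * ((v / π : ℝ) : ℂ)) - 1 / ((v / π : ℝ) : ℂ) := (cot_series_rep' hx).symm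
  rw [e] at hs
  have hs2 := hs.mul_left (-(v / (2 * π) : ℝ) : ℂ)
  rw [← Complex.hasSum_ofReal]
  convert! hs2 using 1
  · ext n
    rw [cotTerm_identity hx]
    have h4 : ((n + 1 : ℕ) : ℝ) ^ 2 * π ^ 2 - v ^ 2 ≠ 0 := by
      have : (1 : ℝ) ≤ ((n + 1 : ℕ) : ℝ) := by push_cast; linarith [n.cast_nonneg (α := ℝ)]
      have h5 : π ≤ ((n + 1 : ℕ) : ℝ) * π := by nlinarith
      nlinarith
    have h5 : (v / π + (n + 1)) * (v / π - (n + 1)) =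
        -((((n + 1 : ℕ) : ℝ) ^ 2 * π ^ 2 - v ^ 2) / π ^ 2) := by
      push_cast
      field_simp
      ring
    have : v ^ 2 / (((n + 1 : ℕ) : ℝ) ^ 2 * π ^ 2 - v ^ 2) =
        -(v / (2 * π)) * (2 * (v / π) * (1 / ((v / π + (n + 1)) * (v / π - (n + 1))))) := by
      rw [h5]
      field_simp
    rw [this]
    push_cast
    ring
  · have hsin : sin v ≠ 0 := (sin_pos_of_pos_of_lt_pi h0 h1).ne'
    have : (1 - mulCot v) / 2 = -(v / (2 * π)) * (π * (cos v / sin v) - 1 / (v / π)) := by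
      rw [mulCot_of_ne_zero h0.ne']
      field_simp
      ring
    rw [this, show (π : ℂ) * ((v / π : ℝ) : ℂ) = (v : ℂ) by
      push_cast; field_simp, Complex.cot]
    push_cast
    ring

/-- Each partial fraction is a geometric series in (v/(nπ))². All terms are nonnegative, so the
double sum may be taken in the other order, giving even zeta values. -/
theorem hasSum_zeta_mul_pow {v : ℝ} (h0 : 0 < v) (h1 : v < π) :
    HasSum (fun k : ℕ => (∑' n : ℕ, 1 / (n : ℝ) ^ (2 * (k + 1))) * (v / π) ^ (2 * (k + 1)))
      ((1 - mulCot v) / 2) := by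
  have hpi := pi_pos
  have hq : 0 < v / π := div_pos h0 hpi
  have hq1 : v / π < 1 := (div_lt_one hpi).2 h1
  set F : ℕ × ℕ → ℝ := fun p => 1 / ((p.1 + 1 : ℕ) : ℝ) ^ (2 * (p.2 + 1)) *
    (v / π) ^ (2 * (p.2 + 1)) with hF
  have hrow : ∀ n, HasSum (fun k => F (n, k))
      (v ^ 2 / (((n + 1 : ℕ) : ℝ) ^ 2 * π ^ 2 - v ^ 2)) := by
    intro n
    have hn : (1 : ℝ) ≤ ((n + 1 : ℕ) : ℝ) := by push_cast; linarith [n.cast_nonneg (α := ℝ)]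
    have hr0 : 0 < v / π / ((n + 1 : ℕ) : ℝ) := by positivity
    have hr1 : v / π / ((n + 1 : ℕ) : ℝ) < 1 := (div_lt_one (by linarith)).2 (by linarith)
    have hg := (hasSum_geometric_of_lt_one (sq_nonneg (v / π / ((n + 1 : ℕ) : ℝ)))
      (by nlinarith)).mul_left ((v / π / ((n + 1 : ℕ) : ℝ)) ^ 2)
    convert! hg using 1
    · ext k
      rw [← pow_mul, ← pow_add, div_pow]
      ring
    · have h2 : 1 - (v / π / ((n + 1 : ℕ) : ℝ)) ^ 2 ≠ 0 := by nlinarith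
      have h4 : ((n + 1 : ℕ) : ℝ) ^ 2 * π ^ 2 - v ^ 2 ≠ 0 := by
        have h5 : π ≤ ((n + 1 : ℕ) : ℝ) * π := by nlinarith
        nlinarith
      rw [← div_eq_mul_inv, div_eq_div_iff h4 h2]
      have : ((n + 1 : ℕ) : ℝ) ≠ 0 := by positivity
      field_simp
  have hnn : ∀ p, 0 ≤ F p := fun p => by positivity
  have hsum : Summable F := (summable_prod_of_nonneg hnn).2
    ⟨fun n => (hrow n).summable, by
      simpa only [(hrow _).tsum_eq] using (hasSum_inv_sq_sub_sq h0 h1).summable⟩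
  have htot : HasSum F ((1 - mulCot v) / 2) := by
    have h := hsum.hasSum.prod_fiberwise hrow
    rw [← h.unique (hasSum_inv_sq_sub_sq h0 h1)]
    exact hsum.hasSum
  refine HasSum.prod_fiberwise ((Equiv.prodComm ℕ ℕ).hasSum_iff.2 htot) fun k => ?_
  refine HasSum.mul_right _ ?_
  have hz := (summable_one_div_nat_pow (p := 2 * (k + 1))).2 (by omega)
  -- The term n = 0 that is split off is 1/0 = 0.
  have h := (hasSum_nat_add_iff' 1).2 hz.hasSum
  simpa using h

theorem hasSum_mulCot {v : ℝ} (hv : v ∈ Set.Ico 0 π) :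
    HasSum (fun k : ℕ => (-1) ^ k * (bernoulli (2 * k) : ℝ) * (2 * v) ^ (2 * k) /
      ((2 * k).factorial : ℝ)) (mulCot v) := by
  rcases hv.1.eq_or_lt with rfl | h0
  · convert hasSum_single (f := fun k : ℕ => (-1) ^ k * (bernoulli (2 * k) : ℝ) *
      (2 * 0) ^ (2 * k) / ((2 * k).factorial : ℝ)) 0 ?_ using 1
    · simp [mulCot]
    · intro k hk
      simp [hk]
  · have hpi := pi_pos
    rw [← hasSum_nat_add_iff' 1]
    have h := (hasSum_zeta_mul_pow h0 hv.2).mul_left (-2)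
    convert! h using 1
    · ext k
      rw [(hasSum_zeta_nat (Nat.succ_ne_zero k)).tsum_eq]
      have e : 2 * (k + 1) - 1 = 2 * k + 1 := by omega
      simp only [Nat.succ_eq_add_one, e]
      rw [div_pow, mul_pow]
      have : π ^ (2 * (k + 1)) ≠ 0 := by positivity
      field_simp
      ring
    · simp
      ring

end CotSeries

/-! ### Integrals of v cot v -/

section CotIntegral
open Real

/-- Integration by parts with (-cot)' = 1 + cot². The boundary term v^{m+2} cot v vanishes at both
ends, and the summand 1 produces the last term. -/
theorem integral_pow_mul_mulCot_sq (m : ℕ) :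
    ∫ v in (0 : ℝ)..(π / 2), v ^ m * mulCot v ^ 2 =
      (m + 2) * (∫ v in (0 : ℝ)..(π / 2), v ^ m * mulCot v) - (π / 2) ^ (m + 3) / (m + 3) := by
  have hpi : 0 ≤ π / 2 := by positivity
  have hc := continuousOn_mulCot
  have hc' : ContinuousOn mulCot (Set.uIcc 0 (π / 2)) := by rwa [Set.uIcc_of_le hpi]
  have hi1 : IntervalIntegrable (fun v => v ^ m * mulCot v ^ 2) volume 0 (π / 2) :=
    ContinuousOn.intervalIntegrable (by fun_prop)
  have hi2 : IntervalIntegrable (fun v => v ^ m * mulCot v) volume 0 (π / 2) :=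
    ContinuousOn.intervalIntegrable (by fun_prop)
  have h := intervalIntegral.integral_eq_sub_of_hasDerivAt_of_le hpi
    (f := fun v => -(v ^ (m + 1) * mulCot v) - v ^ (m + 3) / (m + 3))
    (f' := fun v => v ^ m * mulCot v ^ 2 - (m + 2) * (v ^ m * mulCot v)) (by fun_prop) ?_
    (hi1.sub (hi2.const_mul _))
  · rw [intervalIntegral.integral_sub hi1 (hi2.const_mul _),
      intervalIntegral.integral_const_mul] at h
    simp only [mulCot, cos_pi_div_two] at h ⊢
    simp at h
    linarith
  · intro v hv
    have hv0 : v ≠ 0 := hv.1.ne'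
    have hsin : sin v ≠ 0 := (sin_pos_of_pos_of_lt_pi hv.1 (by linarith [hv.2, pi_pos])).ne'
    have hd := ((hasDerivAt_pow (m + 2) v).mul
      ((hasDerivAt_cos v).div (hasDerivAt_sin v) hsin)).neg.sub
      ((hasDerivAt_pow (m + 3) v).div_const ((m : ℝ) + 3))
    have he : (fun v => -(v ^ (m + 1) * mulCot v) - v ^ (m + 3) / ((m : ℝ) + 3)) =ᶠ[nhds v]
        fun v => -(v ^ (m + 2) * (cos v / sin v)) - v ^ (m + 3) / ((m : ℝ) + 3) := by
      filter_upwards [isOpen_ne.mem_nhds hv0] with y hy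
      rw [mulCot_of_ne_zero hy]
      ring
    refine (hd.congr_of_eventuallyEq he).congr_deriv ?_
    rw [mulCot_of_ne_zero hv0]
    have hsc : sin v ^ 2 = 1 - cos v ^ 2 := by rw [← sin_sq_add_cos_sq v]; ring
    have hm : (m : ℝ) + 3 ≠ 0 := by positivity
    simp only [Pi.div_apply, show m + 2 - 1 = m + 1 by omega,
      show m + 3 - 1 = m + 2 by omega]
    push_cast
    field_simp
    rw [hsc]
    ring

/-- Termwise integration, dominated by the values at v = π/2, which lies inside the range of
absolute convergence v < π. -/
theorem hasSum_biasTerm (m : ℕ) :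
    HasSum (biasTerm (m + 3))
      ((∫ v in (0 : ℝ)..(π / 2), v ^ m * mulCot v) / (π / 2) ^ (m + 1)) := by
  have hpi := pi_pos
  have hpi2 : 0 ≤ π / 2 := by positivity
  set a : ℕ → ℝ := fun k => (-1) ^ k * (bernoulli (2 * k) : ℝ) * 2 ^ (2 * k) /
      ((2 * k).factorial : ℝ) with ha
  have hv : ∀ v ∈ Set.Ico 0 π, HasSum (fun k => a k * v ^ (2 * k)) (mulCot v) := fun v hv => by
    convert hasSum_mulCot hv using 2 with k
    simp only [ha, mul_pow]
    ring
  have hs : Summable fun k => |a k * (π / 2) ^ (2 * k)| :=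
    (hv (π / 2) ⟨hpi2, by linarith⟩).summable.abs
  have h := intervalIntegral.hasSum_integral_of_dominated_convergence (μ := volume)
    (a := 0) (b := π / 2) (F := fun k v => v ^ m * (a k * v ^ (2 * k)))
    (f := fun v => v ^ m * mulCot v)
    (fun k _ => (π / 2) ^ m * |a k * (π / 2) ^ (2 * k)|) (fun k => by fun_prop) ?_ ?_ ?_ ?_
  · have h2 := h.div_const ((π / 2) ^ (m + 1))
    convert! h2 using 2 with k
    have e : ∀ v : ℝ, v ^ m * (a k * v ^ (2 * k)) = a k * v ^ (m + 2 * k) := fun v => by ring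
    have hI : ∫ v in (0 : ℝ)..(π / 2), v ^ m * (a k * v ^ (2 * k)) =
        a k * ((π / 2) ^ (m + 2 * k + 1) / (m + 2 * k + 1)) := by
      simp only [e, intervalIntegral.integral_const_mul, integral_pow]
      simp
    have h3 : (m : ℝ) + 2 * k + 1 ≠ 0 := by positivity
    have h4 : ((m + 3 : ℕ) : ℝ) + 2 * k - 2 = m + 2 * k + 1 := by push_cast; ring
    rw [hI, biasTerm, h4, show m + 2 * k + 1 = (m + 1) + 2 * k by ring,
      pow_add (π / 2), div_pow π 2 (2 * k)]
    simp only [ha]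
    field_simp
  · intro k
    refine Filter.Eventually.of_forall fun v hv => ?_
    rw [Set.uIoc_of_le hpi2] at hv
    rw [norm_mul, norm_pow, norm_of_nonneg hv.1.le]
    refine mul_le_mul (pow_le_pow_left₀ hv.1.le hv.2 _) ?_ (norm_nonneg _) (by positivity)
    rw [norm_eq_abs, abs_mul, abs_mul, abs_of_nonneg (pow_nonneg hv.1.le _),
      abs_of_nonneg (pow_nonneg hpi2 _)]
    exact mul_le_mul_of_nonneg_left (pow_le_pow_left₀ hv.1.le hv.2 _) (abs_nonneg _)
  · exact Filter.Eventually.of_forall fun v _ => hs.mul_left _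
  · exact intervalIntegrable_const
  · refine Filter.Eventually.of_forall fun v hv' => ?_
    rw [Set.uIoc_of_le hpi2] at hv'
    exact (hv v ⟨hv'.1.le, by linarith [hv'.2]⟩).mul_left _

end CotIntegral

/-! ### From the arctangent tail to a cotangent integral -/

section LayerCake
open Real

theorem volume_lt_pi_div_two_sub_arctan_sqrt {v : ℝ} (hv : 0 < v) :
    (volume.restrict (Set.Ioi 0)) {u : ℝ | v < π / 2 - arctan √u} =
      if v < π / 2 then ENNReal.ofReal ((cos v / sin v) ^ 2) else 0 := by
  have hm : MeasurableSet {u : ℝ | v < π / 2 - arctan √u} :=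
    measurableSet_lt (by fun_prop) (by fun_prop)
  rw [Measure.restrict_apply hm]
  split_ifs with h
  · have hsin : 0 < sin v := sin_pos_of_pos_of_lt_pi hv (by linarith)
    have hcos : 0 < cos v := cos_pos_of_mem_Ioo ⟨by linarith, h⟩
    have hct : 0 < cos v / sin v := div_pos hcos hsin
    have hset : {u : ℝ | v < π / 2 - arctan √u} ∩ Set.Ioi 0 = Set.Ioo 0 ((cos v / sin v) ^ 2) := by
      ext u
      simp only [Set.mem_inter_iff, Set.mem_ofPred_eq, Set.mem_Ioi, Set.mem_Ioo]
      have hiff : v < π / 2 - arctan √u ↔ √u < cos v / sin v := by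
        have h1 : arctan (cos v / sin v) = π / 2 - v := by
          rw [← sin_pi_div_two_sub, ← cos_pi_div_two_sub v, ← tan_eq_sin_div_cos]
          exact arctan_tan (by linarith) (by linarith)
        rw [← arctan_strictMono.lt_iff_lt (a := √u), h1, lt_sub_comm]
      rw [hiff, sqrt_lt' hct, and_comm]
    rw [hset, volume_Ioo, sub_zero]
  · have hset : {u : ℝ | v < π / 2 - arctan √u} ∩ Set.Ioi 0 = ∅ := by
      ext u
      simp only [Set.mem_inter_iff, Set.mem_ofPred_eq, Set.mem_empty_iff_false, iff_false, not_and]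
      intro h1
      have := arctan_nonneg.2 (sqrt_nonneg u)
      linarith
    rw [hset, measure_empty]

/-- Layer cake for f(u) = π/2 - arctan √u: the set {f > v} is (0, cot² v) for v < π/2, and g is the
derivative of (2t/π)^{m+3}. The power m + 3 absorbs the pole of cot² at 0. -/
theorem lintegral_pi_div_two_sub_arctan_pow (m : ℕ) :
    ∫⁻ u in Set.Ioi (0 : ℝ), ENNReal.ofReal ((2 / π * (π / 2 - arctan √u)) ^ (m + 3)) =
      ENNReal.ofReal ((m + 3) * (2 / π) ^ (m + 3) *
        ∫ v in (0 : ℝ)..(π / 2), v ^ m * mulCot v ^ 2) := by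
  have hpi := pi_pos
  have hpi2 : 0 ≤ π / 2 := by positivity
  set g : ℝ → ℝ := fun v => (m + 3) * (2 / π) ^ (m + 3) * v ^ (m + 2) with hg
  have hgi : ∀ t, ∫ v in (0 : ℝ)..t, g v = (2 / π * t) ^ (m + 3) := fun t => by
    simp only [hg, intervalIntegral.integral_const_mul, integral_pow]
    have : (m : ℝ) + 3 ≠ 0 := by positivity
    rw [mul_pow]
    push_cast
    field_simp
    ring
  have h := lintegral_comp_eq_lintegral_meas_lt_mul (volume.restrict (Set.Ioi (0 : ℝ)))
    (f := fun u => π / 2 - arctan √u) (g := g)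
    (Filter.Eventually.of_forall fun u => by
      simpa using (arctan_lt_pi_div_two √u).le)
    (by fun_prop) (fun t _ => Continuous.intervalIntegrable (by fun_prop) _ _)
    (by
      filter_upwards [ae_restrict_mem measurableSet_Ioi] with v hv
      have : 0 < v := hv
      positivity)
  simp only [hgi] at h
  rw [h]
  have hc := continuousOn_mulCot
  have hint : IntegrableOn (fun v => (m + 3) * (2 / π) ^ (m + 3) * (v ^ m * mulCot v ^ 2))
      (Set.Ioo 0 (π / 2)) :=
    (ContinuousOn.integrableOn_Icc (by fun_prop)).mono_set Set.Ioo_subset_Icc_self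
  rw [← intervalIntegral.integral_const_mul, intervalIntegral.integral_of_le hpi2,
    integral_Ioc_eq_integral_Ioo, ofReal_integral_eq_lintegral_ofReal hint (by
      filter_upwards [ae_restrict_mem measurableSet_Ioo] with v hv
      have : 0 < v := hv.1
      positivity)]
  rw [← lintegral_indicator measurableSet_Ioi, ← lintegral_indicator measurableSet_Ioo]
  congr 1
  ext v
  by_cases hv : 0 < v
  · rw [Set.indicator_of_mem (Set.mem_Ioi.2 hv), volume_lt_pi_div_two_sub_arctan_sqrt hv]
    split_ifs with h1
    · rw [Set.indicator_of_mem (Set.mem_Ioo.2 ⟨hv, h1⟩), ← ENNReal.ofReal_mul (sq_nonneg _),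
        mulCot_of_ne_zero hv.ne']
      congr 1
      simp only [hg]
      ring
    · rw [Set.indicator_of_notMem (fun h => h1 h.2), zero_mul]
  · rw [Set.indicator_of_notMem (s := Set.Ioi 0) hv, Set.indicator_of_notMem (fun h => hv h.1)]

end LayerCake

/-! ### The ratio of two Gaussians -/

section GaussianRatio
open Real

theorem lintegral_comp_abs_eq (f : ℝ → ENNReal) :
    ∫⁻ z, f |z| = 2 * ∫⁻ z in Set.Ioi (0 : ℝ), f z := by
  have h1 : ∫⁻ z in Set.Ioi (0 : ℝ), f |z| = ∫⁻ z in Set.Ioi (0 : ℝ), f z :=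
    setLIntegral_congr_fun measurableSet_Ioi fun z hz => by
      simp only [abs_of_pos (Set.mem_Ioi.1 hz)]
  have h2 : ∫⁻ z in Set.Iic (0 : ℝ), f |z| = ∫⁻ z in Set.Ioi (0 : ℝ), f |z| := by
    have := (Measure.measurePreserving_neg (volume : Measure ℝ)).setLIntegral_comp_emb
      (Homeomorph.neg ℝ).measurableEmbedding (fun z => f |z|) (Set.Iio 0)
    simp only [abs_neg] at this
    rw [setLIntegral_congr Iio_ae_eq_Iic.symm, this]
    simp
  rw [← setLIntegral_univ, ← Set.Iic_union_Ioi (a := (0 : ℝ)),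
    lintegral_union measurableSet_Ioi (Set.Iic_disjoint_Ioi le_rfl), h2, h1, two_mul]

theorem lintegral_Ioi_comp_mul {f : ℝ → ENNReal} {z c : ℝ} (hz : 0 < z) :
    ∫⁻ x in Set.Ioi (z * c), f x = ENNReal.ofReal z * ∫⁻ w in Set.Ioi c, f (z * w) := by
  have h := lintegral_image_eq_lintegral_abs_deriv_mul (s := Set.Ioi c) (f := fun w => z * w)
    (f' := fun _ => z) measurableSet_Ioi
    (fun u _ => by simpa using ((hasDerivAt_id u).const_mul z).hasDerivWithinAt)
    (fun u _ v _ huv => mul_left_cancel₀ hz.ne' huv) f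
  rw [Set.image_mul_left_Ioi hz] at h
  rw [h, abs_of_pos hz, lintegral_const_mul' _ _ ENNReal.ofReal_ne_top]

theorem gaussianReal_lt_abs {a : ℝ} (ha : 0 ≤ a) :
    gaussianReal 0 1 {z | a < |z|} = 2 * ∫⁻ z in Set.Ioi a, gaussianPDF 0 1 z := by
  have hp : ∀ z : ℝ, gaussianPDF 0 1 |z| = gaussianPDF 0 1 z := fun z => by
    simp [gaussianPDF, gaussianPDFReal]
  have hm : MeasurableSet {z : ℝ | a < |z|} := measurableSet_lt (by fun_prop) (by fun_prop)
  rw [gaussianReal_apply 0 one_ne_zero, ← lintegral_indicator hm]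
  have h := lintegral_comp_abs_eq ((Set.Ioi a).indicator (gaussianPDF 0 1))
  rw [setLIntegral_indicator measurableSet_Ioi,
    Set.inter_eq_left.2 (Set.Ioi_subset_Ioi ha)] at h
  rw [← h]
  congr 1
  ext z
  simp only [Set.indicator_apply, Set.mem_ofPred_eq, Set.mem_Ioi, hp]

theorem lintegral_Ioi_mul_gaussianPDF_mul (w : ℝ) :
    ∫⁻ z in Set.Ioi (0 : ℝ), ENNReal.ofReal z * (gaussianPDF 0 1 (z * w) * gaussianPDF 0 1 z) =
      ENNReal.ofReal ((2 * π)⁻¹ * (1 + w ^ 2)⁻¹) := by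
  set b : ℝ := (1 + w ^ 2) / 2 with hb
  have hb0 : 0 < b := by positivity
  have hder : ∀ z ∈ Set.Ici (0 : ℝ), HasDerivAt
      (fun z => -((2 * π)⁻¹ * (1 + w ^ 2)⁻¹ * exp (-(b * z ^ 2))))
      ((2 * π)⁻¹ * (z * exp (-(b * z ^ 2)))) z := by
    intro z _
    have h1 := (((hasDerivAt_pow 2 z).const_mul b).neg.exp.const_mul
      ((2 * π)⁻¹ * (1 + w ^ 2)⁻¹)).neg
    refine h1.congr_deriv ?_
    have : (1 + w ^ 2) ≠ 0 := by positivity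
    simp only [hb, Pi.neg_apply]
    field_simp
    push_cast
    ring_nf
  have hlim : Filter.Tendsto (fun z => -((2 * π)⁻¹ * (1 + w ^ 2)⁻¹ * exp (-(b * z ^ 2))))
      Filter.atTop (nhds 0) := by
    have h1 := (tendsto_exp_neg_atTop_nhds_zero.comp
      ((Filter.tendsto_pow_atTop (α := ℝ) two_ne_zero).const_mul_atTop hb0)).const_mul
      ((2 * π)⁻¹ * (1 + w ^ 2)⁻¹)
    simpa using h1.neg
  have hnn : ∀ z ∈ Set.Ioi (0 : ℝ), 0 ≤ (2 * π)⁻¹ * (z * exp (-(b * z ^ 2))) := fun z hz => by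
    have : 0 < z := hz
    positivity
  have hint := integrableOn_Ioi_deriv_of_nonneg' hder hnn hlim
  have hval := integral_Ioi_of_hasDerivAt_of_nonneg' hder hnn hlim
  have hval' : ∫ z in Set.Ioi (0 : ℝ), (2 * π)⁻¹ * (z * exp (-(b * z ^ 2))) =
      (2 * π)⁻¹ * (1 + w ^ 2)⁻¹ := by
    rw [hval]; simp
  rw [← hval', ofReal_integral_eq_lintegral_ofReal hint
    ((ae_restrict_mem measurableSet_Ioi).mono hnn)]
  refine setLIntegral_congr_fun measurableSet_Ioi fun z hz => ?_
  have hz : 0 < z := hz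
  simp only [gaussianPDF, gaussianPDFReal]
  rw [← ENNReal.ofReal_mul (by positivity), ← ENNReal.ofReal_mul (by positivity)]
  congr 1
  have h2 : (√(2 * π))⁻¹ * (√(2 * π))⁻¹ = (2 * π)⁻¹ := by
    rw [← mul_inv, mul_self_sqrt (by positivity)]
  have h3 : exp (-(b * z ^ 2)) = exp (-(z * w) ^ 2 / 2) * exp (-z ^ 2 / 2) := by
    rw [← exp_add]
    congr 1
    simp only [hb]
    ring
  simp only [NNReal.coe_one, mul_one, sub_zero]
  rw [h3, ← h2]
  ring

theorem lintegral_Ioi_inv_one_add_sq (c : ℝ) :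
    ∫⁻ w in Set.Ioi c, ENNReal.ofReal ((2 * π)⁻¹ * (1 + w ^ 2)⁻¹) =
      ENNReal.ofReal ((2 * π)⁻¹ * (π / 2 - arctan c)) := by
  rw [← integral_Ioi_inv_one_add_sq, ← integral_const_mul,
    ofReal_integral_eq_lintegral_ofReal]
  · exact (integrable_inv_one_add_sq.const_mul _).integrableOn
  · exact Filter.Eventually.of_forall fun w => by positivity

/-- The ratio of two independent standard Gaussian variables is Cauchy distributed. -/
theorem gaussianReal_prod_mul_abs_lt_abs {c : ℝ} (hc : 0 ≤ c) :
    ((gaussianReal 0 1).prod (gaussianReal 0 1)) {p | c * |p.1| < |p.2|} =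
      ENNReal.ofReal (2 / π * (π / 2 - arctan c)) := by
  have hm : MeasurableSet {p : ℝ × ℝ | c * |p.1| < |p.2|} :=
    measurableSet_lt (by fun_prop) (by fun_prop)
  have hpdf : Measurable (gaussianPDF 0 1) := measurable_gaussianPDF 0 1
  have hsec : ∀ z : ℝ, gaussianReal 0 1 (Prod.mk z ⁻¹' {p : ℝ × ℝ | c * |p.1| < |p.2|}) =
      2 * ∫⁻ x in Set.Ioi (|z| * c), gaussianPDF 0 1 x := fun z => by
    rw [← gaussianReal_lt_abs (by positivity)]
    simp only [Set.preimage_ofPred_eq, mul_comm c]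
  rw [Measure.prod_apply hm]
  simp only [hsec]
  have hmeas : Measurable fun z : ℝ => 2 * ∫⁻ x in Set.Ioi (|z| * c), gaussianPDF 0 1 x := by
    simp only [← hsec]
    exact measurable_measure_prodMk_left hm
  conv_lhs => rw [gaussianReal_of_var_ne_zero 0 one_ne_zero]
  rw [lintegral_withDensity_eq_lintegral_mul _ hpdf hmeas]
  have habs := lintegral_comp_abs_eq
    (fun z => gaussianPDF 0 1 z * (2 * ∫⁻ x in Set.Ioi (z * c), gaussianPDF 0 1 x))
  have hp : ∀ z : ℝ, gaussianPDF 0 1 |z| = gaussianPDF 0 1 z := fun z => by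
    simp [gaussianPDF, gaussianPDFReal]
  simp only [hp] at habs
  simp only [Pi.mul_apply]
  rw [habs]
  -- The substitution x = zw frees the inner domain from z, so Tonelli lets z be integrated first,
  -- leaving the Cauchy density.
  calc 2 * ∫⁻ z in Set.Ioi (0 : ℝ),
        gaussianPDF 0 1 z * (2 * ∫⁻ x in Set.Ioi (z * c), gaussianPDF 0 1 x)
      = 2 * ∫⁻ z in Set.Ioi (0 : ℝ), 2 * ∫⁻ w in Set.Ioi c,
          ENNReal.ofReal z * (gaussianPDF 0 1 (z * w) * gaussianPDF 0 1 z) := by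
        congr 1
        refine setLIntegral_congr_fun measurableSet_Ioi fun z hz => ?_
        rw [lintegral_Ioi_comp_mul hz, lintegral_const_mul' _ _ ENNReal.ofReal_ne_top,
          lintegral_mul_const' _ _ gaussianPDF_ne_top]
        ring
    _ = 4 * ∫⁻ z in Set.Ioi (0 : ℝ), ∫⁻ w in Set.Ioi c,
          ENNReal.ofReal z * (gaussianPDF 0 1 (z * w) * gaussianPDF 0 1 z) := by
        rw [lintegral_const_mul' _ _ ENNReal.ofNat_ne_top, ← mul_assoc]
        norm_num
    _ = 4 * ∫⁻ w in Set.Ioi c, ENNReal.ofReal ((2 * π)⁻¹ * (1 + w ^ 2)⁻¹) := by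
        rw [lintegral_lintegral_swap (by fun_prop)]
        simp only [lintegral_Ioi_mul_gaussianPDF_mul]
    _ = ENNReal.ofReal (2 / π * (π / 2 - arctan c)) := by
        rw [lintegral_Ioi_inv_one_add_sq, show (4 : ENNReal) = ENNReal.ofReal 4 by simp,
          ← ENNReal.ofReal_mul (by norm_num)]
        congr 1
        field_simp
        ring

end GaussianRatio

/-! ### The constant for α = 1/2 -/

section HalfStable
open Real

theorem biasConst_half (m : ℕ) :
    biasConst (m + 3) (1 / 2) = ENNReal.ofReal ((m + 3) * (2 / π) ^ (m + 3) *
        ∫ v in (0 : ℝ)..(π / 2), v ^ m * mulCot v ^ 2) := by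
  set γ := gaussianReal 0 1 with hγ
  rw [isSkewedStable_map_inv_sq_gaussianReal.biasConst_eq (by norm_num) (by norm_num),
    ← lintegral_pi_div_two_sub_arctan_pow]
  refine setLIntegral_congr_fun measurableSet_Ioi fun u hu => ?_
  have hu : 0 < u := hu
  have hm : MeasurableSet {p : ℝ × ℝ | u < p.2 / p.1} :=
    measurableSet_lt (by fun_prop) (by fun_prop)
  have hnn : 0 ≤ 2 / π * (π / 2 - arctan √u) :=
    mul_nonneg (by positivity) (by linarith [arctan_lt_pi_div_two √u])
  rw [ENNReal.ofReal_pow hnn, ← gaussianReal_prod_mul_abs_lt_abs (sqrt_nonneg u), ← hγ,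
    Measure.map_prod_map _ _ (by fun_prop) (by fun_prop), Measure.map_apply (by fun_prop) hm]
  -- Inverting the squares reverses the ratio; exchanging the two coordinates restores the order.
  conv_lhs => rw [← Measure.prod_swap,
    Measure.map_apply measurable_swap (hm.preimage (by fun_prop))]
  congr 1
  have h0 : ∀ᵐ z ∂γ, z ≠ 0 := by
    have : NullSingletonClass γ := nullSingletonClass_gaussianReal one_ne_zero
    simp [ae_iff]
  have h1 : ∀ᵐ p ∂γ.prod γ, p.1 ≠ 0 ∧ p.2 ≠ 0 :=
    (Measure.quasiMeasurePreserving_fst.ae h0).and (Measure.quasiMeasurePreserving_snd.ae h0)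
  refine measure_congr (μ := γ.prod γ) ?_
  filter_upwards [h1] with p hp
  have h2 : 0 < p.1 ^ 2 := by have := hp.1; positivity
  refine propext ?_
  change u < 1 / p.1 ^ 2 / (1 / p.2 ^ 2) ↔ √u * |p.1| < |p.2|
  rw [show 1 / p.1 ^ 2 / (1 / p.2 ^ 2) = p.2 ^ 2 / p.1 ^ 2 by simp [div_eq_mul_inv, mul_comm],
    lt_div_iff₀ h2,
    ← pow_lt_pow_iff_left₀ (a := √u * |p.1|) (by positivity) (abs_nonneg p.2) two_ne_zero,
    mul_pow, sq_sqrt hu.le, sq_abs, sq_abs]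

/-- With M = m + 3, the factor m + 2 from integration by parts is M - 1, and its last term (π/2)^M /
M times M(2/π)^M is the subtracted 1. -/
theorem biasConst_half_toReal (m : ℕ) :
    (biasConst (m + 3) (1 / 2)).toReal =
      ((m + 3 : ℕ) : ℝ) * (((m + 3 : ℕ) : ℝ) - 1) * (4 / π ^ 2) * ∑' j, biasTerm (m + 3) j - 1 := by
  have hpi := pi_pos
  have hnn : 0 ≤ ∫ v in (0 : ℝ)..(π / 2), v ^ m * mulCot v ^ 2 :=
    intervalIntegral.integral_nonneg (by positivity) fun v hv =>
      mul_nonneg (pow_nonneg hv.1 _) (sq_nonneg _)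
  rw [biasConst_half, ENNReal.toReal_ofReal (by positivity), integral_pow_mul_mulCot_sq,
    (hasSum_biasTerm m).tsum_eq]
  have h1 : (m : ℝ) + 3 ≠ 0 := by positivity
  push_cast
  simp only [div_pow]
  field_simp
  ring

end HalfStable

theorem lemma6 :
    (∀ (α : ℝ), 0 < α → α ≤ 1 / 2 →
      ∀ (Ω : Type*) [MeasurableSpace Ω] (P : Measure Ω) [IsProbabilityMeasure P]
        (N M : ℕ), 1 ≤ M →
      ∀ (x : Fin N → ℝ), (∀ i, 0 ≤ x i) →
      ∀ (s : Fin N → Fin M → Ω → ℝ),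
        (∀ i j, AEMeasurable (s i j) P) →
        (∀ i j, IsSkewedStable α (P.map (s i j))) →
        iIndepFun (fun p : Fin N × Fin M => s p.1 p.2) P →
      ∀ i : Fin N,
        (∀ᵐ ω ∂P, x i ≤ minEstimator x (fun t j => s t j ω) i) ∧
        ∫⁻ ω, ENNReal.ofReal (minEstimator x (fun t j => s t j ω) i) ∂P
          = ENNReal.ofReal (x i) + ENNReal.ofReal (thetaOther α x i) * biasConst M α ∧
        (biasConst M α ≠ ⊤ →
          Integrable (fun ω => minEstimator x (fun t j => s t j ω) i) P ∧
          ∫ ω, minEstimator x (fun t j => s t j ω) i ∂P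
            = x i + thetaOther α x i * (biasConst M α).toReal)) ∧
    (∀ M : ℕ, 3 ≤ M →
      biasConst M (1 / 2) ≠ ⊤ ∧
      Summable (biasTerm M) ∧
      (biasConst M (1 / 2)).toReal
        = (M : ℝ) * ((M : ℝ) - 1) * (4 / Real.pi ^ 2) * ∑' j : ℕ, biasTerm M j - 1) := by
  refine ⟨fun α h0 h1 Ω _ P _ N M hM x hx s hs hstab hind i =>
    minEstimator_expectation h0 (by linarith) hM hx hs hstab hind i, fun M hM => ?_⟩
  obtain ⟨m, rfl⟩ := Nat.exists_eq_add_of_le' hM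
  exact ⟨by rw [biasConst_half]; exact ENNReal.ofReal_ne_top, (hasSum_biasTerm m).summable,
    biasConst_half_toReal m⟩
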